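/- For $f\in L^p(\mathbb R)=L^p(\mathbb R;\mathbb C)$, $1\le p<2$, let $\hat f$ be its Fourier transform, normalized by $\hat f(\xi)=\int_{\mathbb R} f(x)e^{-ix\xi}\,dx$ for $f\in L^1(\mathbb R)$ and extended as usual to $L^1(\mathbb R)+L^2(\mathbb R)\supset L^p(\mathbb R)$. For $a>0$, $\gamma>1$ and $t>0$ let $$P^t_{a,\gamma}f(x)=\frac1{2\pi}\int_{\mathbb R}\hat f(\xi)\,e^{ix\xi}\,e^{it|\xi|^a}\,e^{-t^\gamma|\xi|^a}\,d\xi,\qquad x\in\mathbb R.$$ Theorem. Let $a>0$, $\gamma>1$ and $1\le p<2$. Then there exist a function $f_0\in L^p(\mathbb R)$ and a measurable set $E\subset\mathbb R$ of positive Lebesgue measure such that for every $x\in E$ it is not true that $P^t_{a,\gamma}f_0(x)\to f_0(x)$ as $t\to0^+$ (that is, the limit fails to exist or differs from $f_0(x)$). -/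

import Mathlib

open MeasureTheory Filter Topology
open scoped ENNReal FourierTransform

noncomputable section

namespace LandauSchrodinger

/-- The part of `f` where `‖f‖ > 1`. It is integrable when `f ∈ L^p`, `1 ≤ p < ∞`
(see `integrable_largePart`). -/
def largePart (f : ℝ → ℂ) : ℝ → ℂ := {x | 1 < ‖f x‖}.indicator f

/-- The part of `f` where `‖f‖ ≤ 1`. It is square integrable when `f ∈ L^p`, `1 ≤ p ≤ 2`
(see `memLp_smallPart`). -/
def smallPart (f : ℝ → ℂ) : ℝ → ℂ := {x | ‖f x‖ ≤ 1}.indicator f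

theorem largePart_add_smallPart (f : ℝ → ℂ) (x : ℝ) :
    largePart f x + smallPart f x = f x := by
  by_cases h : 1 < ‖f x‖
  · simp [largePart, smallPart, h, not_le.mpr h]
  · simp [largePart, smallPart, h, not_lt.mp h]

theorem integrable_largePart {f : ℝ → ℂ} {p : ℝ≥0∞} (hp : 1 ≤ p) (hp' : p ≠ ∞)
    (hf : MemLp f p volume) : Integrable (largePart f) volume := by
  have hm : NullMeasurableSet {x | 1 < ‖f x‖} volume :=
    nullMeasurableSet_lt aemeasurable_const hf.1.norm.aemeasurable
  have h1 : 1 ≤ p.toReal := by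
    simpa using (ENNReal.toReal_le_toReal ENNReal.one_ne_top hp').mpr hp
  refine (hf.integrable_norm_rpow (by positivity) hp').mono (hf.1.indicator₀ hm) ?_
  refine Eventually.of_forall fun x => ?_
  by_cases h : 1 < ‖f x‖
  · rw [largePart, Set.indicator_of_mem (by exact h), Real.norm_of_nonneg (by positivity)]
    simpa using Real.rpow_le_rpow_of_exponent_le h.le h1
  · rw [largePart, Set.indicator_of_notMem (by exact h), norm_zero]
    positivity

theorem memLp_smallPart {f : ℝ → ℂ} {p : ℝ≥0∞} (hp : 1 ≤ p) (hp' : p ≤ 2)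
    (hf : MemLp f p volume) : MemLp (smallPart f) 2 volume := by
  have hpt : p ≠ ∞ := ne_top_of_le_ne_top (by simp) hp'
  have hm : NullMeasurableSet {x | ‖f x‖ ≤ 1} volume :=
    nullMeasurableSet_le hf.1.norm.aemeasurable aemeasurable_const
  have hs : AEStronglyMeasurable (smallPart f) volume := hf.1.indicator₀ hm
  have h2 : p.toReal ≤ 2 := by
    simpa using (ENNReal.toReal_le_toReal hpt (by simp)).mpr hp'
  have h0 : 0 < p.toReal := ENNReal.toReal_pos (by positivity) hpt
  rw [memLp_two_iff_integrable_sq_norm hs]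
  refine (hf.integrable_norm_rpow (by positivity) hpt).mono (hs.norm.pow 2) ?_
  refine Eventually.of_forall fun x => ?_
  by_cases h : ‖f x‖ ≤ 1
  · rw [smallPart, Set.indicator_of_mem (by exact h), Real.norm_of_nonneg (by positivity),
      Real.norm_of_nonneg (by positivity), ← Real.rpow_natCast]
    exact Real.rpow_le_rpow_of_exponent_ge_of_imp (norm_nonneg _) h (by simpa using h2)
      (fun _ hc => absurd hc (by norm_num))
  · rw [smallPart, Set.indicator_of_notMem (by exact h)]
    simp only [norm_zero, ne_eq, OfNat.ofNat_ne_zero, not_false_eq_true, zero_pow]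
    positivity

open Classical in
/-- The `L²` (Plancherel) Fourier transform of `f ∈ L²(ℝ)` with kernel `e^{-2πi x w}`, as a function
(determined up to null sets). The value `0` is used only for `f ∉ L²(ℝ)`. -/
def plancherel (f : ℝ → ℂ) : ℝ → ℂ :=
  if h : MemLp f 2 volume then (𝓕 (h.toLp f) : Lp ℂ 2 (volume : Measure ℝ)) else 0

/-- The Fourier transform `f̂(ξ) = ∫ f(x) e^{-ixξ} dx` on `L¹(ℝ) + L²(ℝ)`, which contains `L^p(ℝ)` for
`1 ≤ p ≤ 2`: the integral on the `L¹` part, the Plancherel transform on the `L²` part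
(rescaled, since Mathlib's `𝓕` has the kernel `e^{-2πi x w}`). -/
def fourierHat (f : ℝ → ℂ) (ξ : ℝ) : ℂ :=
  (∫ x : ℝ, largePart f x * Complex.exp (-(Complex.I * x * ξ))) +
    plancherel (smallPart f) (ξ / (2 * Real.pi))

/-- The Landau type Schrödinger operator
`P^t f(x) = (1/2π) ∫ f̂(ξ) e^{ixξ} e^{it|ξ|^a} e^{-t^γ |ξ|^a} dξ`, for `t > 0`. -/
def landau (a γ t : ℝ) (f : ℝ → ℂ) (x : ℝ) : ℂ :=
  (1 / (2 * Real.pi) : ℂ) * ∫ ξ : ℝ,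
    fourierHat f ξ * Complex.exp (Complex.I * x * ξ) *
      Complex.exp (Complex.I * t * (|ξ| ^ a : ℝ)) * (Real.exp (-(t ^ γ * |ξ| ^ a)) : ℂ)

end LandauSchrodinger

end

/-! The divergence is forced by a Baire category argument in `L^p`: it suffices to find functions of
arbitrarily small `L^p` norm whose evolution reaches modulus at least 1/4 at every point of `[0,1]`,
at arbitrarily small times (`HasLargeMaximalFunction`). Then for a generic `f` the evolution is
unbounded as `t → 0⁺` at every point of `[0,1]`, so it has no limit there at all.

The small functions are averages of `N` Gaussian wave packets with frequencies `R + n R^{1-θ}`, `n <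
N`. As `R → ∞` the spacing tends to infinity, the packets become orthogonal, and the average has
size about `N^{-1/2}` (`integral_norm_packetAverage_le`).

Let `T = (2π/a) R^{θ-a}`. To first order, `T |ξ|^a` at the `n`-th frequency is `T R^a + 2πn`; the
quadratic term is `O(R^{-θ})` and the variation across one packet is `O(R^{θ-1})`. Hence for `1 ≤ s
≤ 2` time `sT` only multiplies the `n`-th packet by the phase `e^{is(TR^a + 2πn)}`, without moving
it. The damping exponent is of order `R^{a-γ(a-θ)}`, negligible when `θ < a(1 - 1/γ)`; such `θ > 0`
exists because `γ > 1`. Given `x`, some `s` in `[1,2]` makes `R^{1-θ} x + 2πs` a multiple of `2π`;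
all packets are then in phase at `x`, and the average has modulus close to `e^{-x²/2} ≥ 1/2`
(`exists_le_norm_landau_packetAverage`). -/

namespace LandauSchrodinger

/-! ### The Fourier transform on `L¹ + L²` -/

/-- The Plancherel transform of an integrable square integrable function is its Fourier integral. -/
theorem fourier_toLp_ae_eq {f : ℝ → ℂ} (h1 : Integrable f) (h2 : MemLp f 2 volume) :
    ((𝓕 (h2.toLp f) : Lp ℂ 2 (volume : Measure ℝ)) : ℝ → ℂ) =ᵐ[volume] 𝓕 f := by
  have hcont : Continuous (𝓕 f) :=
    VectorFourier.fourierIntegral_continuous Real.continuous_fourierChar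
      (by exact continuous_inner) h1
  refine ae_eq_of_integral_contDiff_smul_eq ?_ hcont.locallyIntegrable ?_
  · exact (Lp.memLp _).locallyIntegrable (by norm_num)
  intro g hg hg'
  have hgc : HasCompactSupport (fun x => (g x : ℂ)) := hg'.comp_left (g := Complex.ofReal) rfl
  have hgs : ContDiff ℝ ((⊤ : ℕ∞) : WithTop ℕ∞) (fun x => (g x : ℂ)) :=
    Complex.ofRealCLM.contDiff.comp hg
  set φ : SchwartzMap ℝ ℂ := hgc.toSchwartzMap hgs with hφ
  have hφg : ∀ x, φ x = (g x : ℂ) := fun x => rfl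
  -- Both sides are tested against a smooth compactly supported function: the `L²` transform agrees
  -- with the distributional one, and the multiplication formula `∫ φ̂ f = ∫ φ f̂` handles the
  -- Fourier integral.
  have key := congrArg (fun T => T φ) (Lp.fourier_toTemperedDistribution_eq (h2.toLp f))
  simp only [TemperedDistribution.fourier_apply, Lp.toTemperedDistribution_apply] at key
  have e1 : ∫ x, g x • ((𝓕 (h2.toLp f) : Lp ℂ 2 (volume : Measure ℝ)) : ℝ → ℂ) x =
      ∫ x, φ x • ((𝓕 (h2.toLp f) : Lp ℂ 2 (volume : Measure ℝ)) : ℝ → ℂ) x := by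
    simp [hφg]
  have e2 : ∫ x, (𝓕 φ) x • (h2.toLp f) x = ∫ x, (𝓕 φ) x • f x := by
    refine integral_congr_ae ?_
    filter_upwards [h2.coeFn_toLp] with x hx
    rw [hx]
  have e3 : ∫ x, (𝓕 φ) x • f x = ∫ x, φ x • 𝓕 f x := by
    have := VectorFourier.integral_fourierIntegral_smul_eq_flip (L := innerₗ ℝ)
      (μ := volume) (ν := volume) (f := fun x => φ x) (g := f)
      Real.continuous_fourierChar (by exact continuous_inner) φ.integrable h1
    rw [flip_innerₗ] at this
    exact this
  rw [e1, ← key, e2, e3]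
  simp [hφg]

theorem plancherel_of_memLp {f : ℝ → ℂ} (h : MemLp f 2 volume) :
    plancherel f = (𝓕 (h.toLp f) : Lp ℂ 2 (volume : Measure ℝ)) := dif_pos h

theorem plancherel_ae_eq {f : ℝ → ℂ} (h1 : Integrable f) (h2 : MemLp f 2 volume) :
    plancherel f =ᵐ[volume] 𝓕 f := by
  rw [plancherel_of_memLp h2]
  exact fourier_toLp_ae_eq h1 h2

theorem plancherel_congr {f g : ℝ → ℂ} (h : f =ᵐ[volume] g) : plancherel f = plancherel g := by
  by_cases hf : MemLp f 2 volume
  · have hg := hf.ae_eq h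
    rw [plancherel_of_memLp hf, plancherel_of_memLp hg, (MemLp.toLp_eq_toLp_iff hf hg).2 h]
  · have hg : ¬ MemLp g 2 volume := fun hg => hf (hg.ae_eq h.symm)
    rw [plancherel, plancherel, dif_neg hf, dif_neg hg]

theorem plancherel_add {f g : ℝ → ℂ} (hf : MemLp f 2 volume) (hg : MemLp g 2 volume) :
    plancherel (f + g) =ᵐ[volume] plancherel f + plancherel g := by
  rw [plancherel_of_memLp hf, plancherel_of_memLp hg, plancherel_of_memLp (hf.add hg),
    MemLp.toLp_add, FourierTransform.fourier_add]
  exact Lp.coeFn_add _ _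

theorem plancherel_const_smul {f : ℝ → ℂ} (c : ℂ) (hf : MemLp f 2 volume) :
    plancherel (c • f) =ᵐ[volume] c • plancherel f := by
  rw [plancherel_of_memLp hf, plancherel_of_memLp (hf.const_smul c),
    MemLp.toLp_const_smul, FourierTransform.fourier_smul]
  exact Lp.coeFn_smul _ _

theorem memLp_plancherel (f : ℝ → ℂ) : MemLp (plancherel f) 2 volume := by
  by_cases hf : MemLp f 2 volume
  · rw [plancherel_of_memLp hf]
    exact Lp.memLp _
  · rw [plancherel, dif_neg hf]
    exact MemLp.zero

theorem eLpNorm_plancherel {f : ℝ → ℂ} (hf : MemLp f 2 volume) :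
    eLpNorm (plancherel f) 2 volume = eLpNorm f 2 volume := by
  rw [plancherel_of_memLp hf, ← Lp.enorm_def, ← Lp.enorm_toLp hf, ← ofReal_norm,
    Lp.norm_fourier_eq, ofReal_norm]

theorem fourier_add_of_integrable {f g : ℝ → ℂ} (hf : Integrable f) (hg : Integrable g) :
    𝓕 (f + g) = 𝓕 f + 𝓕 g :=
  VectorFourier.fourierIntegral_add (L := innerₗ ℝ) Real.continuous_fourierChar
    (by exact continuous_inner) hf hg

/-- The Fourier integral with kernel `e^{-ixξ}`. -/
theorem integral_mul_exp_eq_fourier (f : ℝ → ℂ) (ξ : ℝ) :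
    (∫ x : ℝ, f x * Complex.exp (-(Complex.I * x * ξ))) = 𝓕 f (ξ / (2 * Real.pi)) := by
  rw [Real.fourier_real_eq_integral_exp_smul]
  refine integral_congr_ae (Eventually.of_forall fun x => ?_)
  simp only [smul_eq_mul]
  rw [mul_comm]
  congr 2
  push_cast
  field_simp

theorem ae_eq_comp_div {f g : ℝ → ℂ} (h : f =ᵐ[volume] g) {c : ℝ} (hc : c ≠ 0) :
    (fun x => f (x / c)) =ᵐ[volume] fun x => g (x / c) := by
  have hq : Measure.QuasiMeasurePreserving (fun x : ℝ => x / c) volume volume := by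
    refine ⟨by fun_prop, ?_⟩
    have : (fun x : ℝ => x / c) = fun x => x * c⁻¹ := by
      funext x
      rw [div_eq_mul_inv]
    rw [this, Real.map_volume_mul_right (inv_ne_zero hc)]
    exact Measure.smul_absolutelyContinuous
  exact hq.ae_eq_comp h

theorem two_pi_ne_zero : 2 * Real.pi ≠ 0 := by positivity

/-- The Fourier transform on `L¹ + L²` may be computed from any decomposition. -/
theorem fourierHat_ae_eq {p : ℝ≥0∞} (hp : 1 ≤ p) (hp2 : p ≤ 2) {f u v : ℝ → ℂ}
    (hf : MemLp f p volume) (hu : Integrable u) (hv : MemLp v 2 volume)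
    (h : f =ᵐ[volume] u + v) :
    fourierHat f =ᵐ[volume]
      fun ξ => 𝓕 u (ξ / (2 * Real.pi)) + plancherel v (ξ / (2 * Real.pi)) := by
  have hL := integrable_largePart hp (ne_top_of_le_ne_top (by simp) hp2) hf
  have hS := memLp_smallPart hp hp2 hf
  -- Two decompositions differ by a function in `L¹ ∩ L²`, on which the Fourier integral and the
  -- Plancherel transform agree.
  have hd : (largePart f - u : ℝ → ℂ) =ᵐ[volume] v - smallPart f := by
    filter_upwards [h] with x hx
    have := largePart_add_smallPart f x
    simp only [Pi.sub_apply, Pi.add_apply] at hx ⊢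
    linear_combination this + hx
  have hw1 : Integrable (largePart f - u) := hL.sub hu
  have hw2 : MemLp (largePart f - u) 2 volume := (hv.sub hS).ae_eq hd.symm
  have e1 : 𝓕 (largePart f) = 𝓕 u + 𝓕 (largePart f - u) := by
    have : largePart f = u + (largePart f - u) := by abel
    conv_lhs => rw [this]
    exact fourier_add_of_integrable hu hw1
  have e2 : plancherel v =ᵐ[volume] 𝓕 (largePart f - u) + plancherel (smallPart f) := by
    have : v =ᵐ[volume] (largePart f - u) + smallPart f := by
      filter_upwards [hd] with x hx
      simp only [Pi.sub_apply, Pi.add_apply] at hx ⊢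
      linear_combination -hx
    rw [plancherel_congr this]
    filter_upwards [plancherel_add hw2 hS, plancherel_ae_eq hw1 hw2] with x h1 h2
    rw [h1, Pi.add_apply, h2, Pi.add_apply]
  filter_upwards [ae_eq_comp_div e2 two_pi_ne_zero] with ξ hξ
  rw [fourierHat, integral_mul_exp_eq_fourier, hξ, e1, Pi.add_apply, Pi.add_apply]
  ring

theorem fourierHat_of_decomposition (f : ℝ → ℂ) :
    fourierHat f = fun ξ => 𝓕 (largePart f) (ξ / (2 * Real.pi)) +
      plancherel (smallPart f) (ξ / (2 * Real.pi)) := by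
  funext ξ
  rw [fourierHat, integral_mul_exp_eq_fourier]

theorem fourierHat_add {p : ℝ≥0∞} (hp : 1 ≤ p) (hp2 : p ≤ 2) {f g : ℝ → ℂ}
    (hf : MemLp f p volume) (hg : MemLp g p volume) :
    fourierHat (f + g) =ᵐ[volume] fourierHat f + fourierHat g := by
  have hpt : p ≠ ∞ := ne_top_of_le_ne_top (by simp) hp2
  have hLf := integrable_largePart hp hpt hf
  have hSf := memLp_smallPart hp hp2 hf
  have hLg := integrable_largePart hp hpt hg
  have hSg := memLp_smallPart hp hp2 hg
  have h := fourierHat_ae_eq hp hp2 (hf.add hg) (hLf.add hLg) (hSf.add hSg)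
    (Eventually.of_forall fun x => by
      simp only [Pi.add_apply]
      rw [← largePart_add_smallPart f x, ← largePart_add_smallPart g x]
      ring)
  have e : 𝓕 (largePart f + largePart g) = 𝓕 (largePart f) + 𝓕 (largePart g) :=
    fourier_add_of_integrable hLf hLg
  filter_upwards [h, ae_eq_comp_div (plancherel_add hSf hSg) two_pi_ne_zero] with ξ h1 h2
  rw [h1, h2, e, Pi.add_apply, Pi.add_apply, Pi.add_apply, fourierHat_of_decomposition f,
    fourierHat_of_decomposition g]
  ring

theorem fourierHat_const_smul {p : ℝ≥0∞} (hp : 1 ≤ p) (hp2 : p ≤ 2) {f : ℝ → ℂ} (c : ℂ)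
    (hf : MemLp f p volume) :
    fourierHat (c • f) =ᵐ[volume] c • fourierHat f := by
  have hpt : p ≠ ∞ := ne_top_of_le_ne_top (by simp) hp2
  have hLf := integrable_largePart hp hpt hf
  have hSf := memLp_smallPart hp hp2 hf
  have h := fourierHat_ae_eq hp hp2 (hf.const_smul c) (hLf.smul c) (hSf.const_smul c)
    (Eventually.of_forall fun x => by
      simp only [Pi.add_apply, Pi.smul_apply]
      rw [← smul_add, largePart_add_smallPart f x])
  have e : 𝓕 (c • largePart f) = c • 𝓕 (largePart f) :=
    VectorFourier.fourierIntegral_const_smul _ _ _ _ _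
  filter_upwards [h, ae_eq_comp_div (plancherel_const_smul c hSf) two_pi_ne_zero] with ξ h1 h2
  rw [h1, h2, e, Pi.smul_apply, Pi.smul_apply, Pi.smul_apply, fourierHat_of_decomposition f,
    ← smul_add]

theorem fourierHat_congr {p : ℝ≥0∞} (hp : 1 ≤ p) (hp2 : p ≤ 2) {f g : ℝ → ℂ}
    (hf : MemLp f p volume) (h : f =ᵐ[volume] g) : fourierHat f =ᵐ[volume] fourierHat g := by
  have hpt : p ≠ ∞ := ne_top_of_le_ne_top (by simp) hp2
  have hg := hf.ae_eq h
  rw [fourierHat_of_decomposition g]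
  refine fourierHat_ae_eq hp hp2 hf (integrable_largePart hp hpt hg) (memLp_smallPart hp hp2 hg) ?_
  filter_upwards [h] with x hx
  rw [hx, Pi.add_apply, largePart_add_smallPart]

/-- On `L¹ ∩ L^p` the Fourier transform is the Fourier integral. -/
theorem fourierHat_of_integrable {p : ℝ≥0∞} (hp : 1 ≤ p) (hp2 : p ≤ 2) {f : ℝ → ℂ}
    (hf : MemLp f p volume) (h1 : Integrable f) :
    fourierHat f =ᵐ[volume] fun ξ => 𝓕 f (ξ / (2 * Real.pi)) := by
  have h := fourierHat_ae_eq hp hp2 hf h1 (v := 0) MemLp.zero (by simp)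
  have h0 : plancherel (0 : ℝ → ℂ) =ᵐ[volume] 0 := by
    rw [plancherel_of_memLp MemLp.zero, MemLp.toLp_zero, FourierTransform.fourier_zero]
    exact Lp.coeFn_zero _ _ _
  filter_upwards [h, ae_eq_comp_div h0 two_pi_ne_zero] with ξ h1 h2
  rw [h1, h2]
  simp

/-! ### The multiplier and the `L^p → L^∞` bound -/

theorem eLpNorm_largePart_le_one {p : ℝ≥0∞} (hp : 1 ≤ p) (hp' : p ≠ ∞) {f : ℝ → ℂ}
    (hf : eLpNorm f p volume ≤ 1) : eLpNorm (largePart f) 1 volume ≤ 1 := by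
  have h1 : 1 ≤ p.toReal := by
    simpa using (ENNReal.toReal_le_toReal ENNReal.one_ne_top hp').mpr hp
  rw [eLpNorm_eq_lintegral_rpow_enorm_toReal (by positivity) hp',
    one_div, ENNReal.rpow_inv_le_iff (by positivity), ENNReal.one_rpow] at hf
  rw [eLpNorm_one_eq_lintegral_enorm]
  refine (lintegral_mono fun x => ?_).trans hf
  by_cases h : 1 < ‖f x‖
  · rw [largePart, Set.indicator_of_mem (by exact h)]
    have h' : 1 ≤ ‖f x‖ₑ := by
      rw [← ofReal_norm, ENNReal.one_le_ofReal]
      exact h.le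
    simpa using ENNReal.rpow_le_rpow_of_exponent_le h' h1
  · rw [largePart, Set.indicator_of_notMem (by exact h), enorm_zero]
    positivity

theorem eLpNorm_smallPart_le_one {p : ℝ≥0∞} (hp : 1 ≤ p) (hp2 : p ≤ 2) {f : ℝ → ℂ}
    (hf : eLpNorm f p volume ≤ 1) : eLpNorm (smallPart f) 2 volume ≤ 1 := by
  have hp' : p ≠ ∞ := ne_top_of_le_ne_top (by simp) hp2
  have h0 : 0 < p.toReal := ENNReal.toReal_pos (by positivity) hp'
  have h2 : p.toReal ≤ 2 := by
    simpa using (ENNReal.toReal_le_toReal hp' (by simp)).mpr hp2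
  rw [eLpNorm_eq_lintegral_rpow_enorm_toReal (by positivity) hp',
    one_div, ENNReal.rpow_inv_le_iff (by positivity), ENNReal.one_rpow] at hf
  rw [eLpNorm_eq_lintegral_rpow_enorm_toReal (by positivity) (by simp),
    one_div, ENNReal.rpow_inv_le_iff (by simp), ENNReal.one_rpow]
  refine (lintegral_mono fun x => ?_).trans hf
  by_cases h : ‖f x‖ ≤ 1
  · rw [smallPart, Set.indicator_of_mem (by exact h)]
    have h' : ‖f x‖ₑ ≤ 1 := by
      rw [← ofReal_norm, ENNReal.ofReal_le_one]
      exact h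
    exact ENNReal.rpow_le_rpow_of_exponent_ge h' (by simpa using h2)
  · rw [smallPart, Set.indicator_of_notMem (by exact h), enorm_zero,
      ENNReal.zero_rpow_of_pos (by simp)]
    positivity

/-- The damping factor `e^{-t^γ |ξ|^a}`. -/
noncomputable def damping (a γ t ξ : ℝ) : ℝ := Real.exp (-(t ^ γ * |ξ| ^ a))

/-- The multiplier of `P^t`. -/
noncomputable def multiplier (a γ t ξ : ℝ) : ℂ :=
  Complex.exp (Complex.I * t * (|ξ| ^ a : ℝ)) * (damping a γ t ξ : ℂ)

theorem landau_eq (a γ t : ℝ) (f : ℝ → ℂ) (x : ℝ) :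
    landau a γ t f x = (1 / (2 * Real.pi) : ℂ) * ∫ ξ : ℝ,
      fourierHat f ξ * (Complex.exp (Complex.I * x * ξ) * multiplier a γ t ξ) := by
  simp only [landau, multiplier, damping, mul_assoc]

section
variable {a γ t : ℝ}

theorem continuous_damping (ha : 0 < a) : Continuous (damping a γ t) := by
  have : Continuous fun ξ : ℝ => |ξ| ^ a := continuous_abs.rpow_const fun _ => Or.inr ha.le
  unfold damping
  fun_prop

theorem continuous_multiplier (ha : 0 < a) : Continuous (multiplier a γ t) := by
  have h : Continuous fun ξ : ℝ => |ξ| ^ a := continuous_abs.rpow_const fun _ => Or.inr ha.le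
  have h' := continuous_damping (γ := γ) (t := t) ha
  unfold multiplier
  fun_prop

theorem damping_pos (ξ : ℝ) : 0 < damping a γ t ξ := Real.exp_pos _

theorem damping_anti (hγ : 0 ≤ γ) {s : ℝ} (hs : 0 ≤ s) (hst : s ≤ t) (ξ : ℝ) :
    damping a γ t ξ ≤ damping a γ s ξ := by
  unfold damping
  gcongr

theorem damping_le_one (ht : 0 ≤ t) (ξ : ℝ) : damping a γ t ξ ≤ 1 := by
  rw [damping, Real.exp_le_one_iff, neg_nonpos]
  positivity

theorem norm_multiplier (ξ : ℝ) : ‖multiplier a γ t ξ‖ = damping a γ t ξ := by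
  have h : Complex.I * t * (|ξ| ^ a : ℝ) = ((t * |ξ| ^ a : ℝ) : ℂ) * Complex.I := by
    push_cast
    ring
  rw [multiplier, norm_mul, h, Complex.norm_exp_ofReal_mul_I, one_mul, Complex.norm_real,
    Real.norm_of_nonneg (damping_pos ξ).le]

theorem norm_exp_I_mul_mul (x ξ : ℝ) : ‖Complex.exp (Complex.I * x * ξ)‖ = 1 := by
  have h : Complex.I * x * ξ = ((x * ξ : ℝ) : ℂ) * Complex.I := by
    push_cast
    ring
  rw [h, Complex.norm_exp_ofReal_mul_I]

theorem integrable_exp_neg_mul_abs_rpow (ha : 0 < a) {b : ℝ} (hb : 0 < b) :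
    Integrable fun ξ : ℝ => Real.exp (-b * |ξ| ^ a) := by
  have := (integrable_fun_norm_addHaar (E := ℝ) volume
    (f := fun y : ℝ => Real.exp (-b * y ^ a))).2 (by
      simpa using integrableOn_rpow_mul_exp_neg_mul_rpow (s := 0) (by norm_num) ha hb)
  simpa using this

theorem memLp_damping_one (ha : 0 < a) (ht : 0 < t) :
    MemLp (fun ξ => (damping a γ t ξ : ℂ)) 1 volume := by
  rw [memLp_one_iff_integrable]
  have := (integrable_exp_neg_mul_abs_rpow ha (Real.rpow_pos_of_pos ht γ)).ofReal (𝕜 := ℂ)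
  refine this.congr (Eventually.of_forall fun ξ => ?_)
  simp [damping]

theorem memLp_damping_two (ha : 0 < a) (ht : 0 < t) :
    MemLp (fun ξ => (damping a γ t ξ : ℂ)) 2 volume := by
  have hd : AEStronglyMeasurable (fun ξ => (damping a γ t ξ : ℂ)) volume :=
    (Complex.continuous_ofReal.comp (continuous_damping ha)).aestronglyMeasurable
  rw [memLp_two_iff_integrable_sq_norm hd]
  have := integrable_exp_neg_mul_abs_rpow ha
    (mul_pos two_pos (Real.rpow_pos_of_pos ht γ))
  refine this.congr (Eventually.of_forall fun ξ => ?_)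
  simp only [damping, Complex.norm_real, Real.norm_eq_abs, Real.abs_exp, ← Real.exp_nat_mul]
  congr 1
  push_cast
  ring

theorem eLpNorm_comp_div_two_pi {g : ℝ → ℂ} (hg : AEStronglyMeasurable g volume) :
    eLpNorm (fun ξ => g (ξ / (2 * Real.pi))) 2 volume =
      ENNReal.ofReal (2 * Real.pi) ^ (1 / 2 : ℝ) * eLpNorm g 2 volume := by
  have hmap : Measure.map (fun ξ : ℝ => ξ / (2 * Real.pi)) volume =
      ENNReal.ofReal (2 * Real.pi) • volume := by
    have : (fun x : ℝ => x / (2 * Real.pi)) = fun x => x * (2 * Real.pi)⁻¹ := by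
      funext x
      rw [div_eq_mul_inv]
    rw [this, Real.map_volume_mul_right (inv_ne_zero two_pi_ne_zero), inv_inv,
      abs_of_pos Real.two_pi_pos]
  have h := eLpNorm_map_measure (p := 2) (μ := (volume : Measure ℝ))
    (f := fun ξ : ℝ => ξ / (2 * Real.pi)) (g := g)
    (by rw [hmap]; exact hg.smul_measure _) (by fun_prop)
  rw [hmap, eLpNorm_smul_measure_of_ne_top (by simp)] at h
  rw [← Function.comp_def, ← h]
  simp

theorem aestronglyMeasurable_plancherel_comp_div (g : ℝ → ℂ) :
    AEStronglyMeasurable (fun ξ => plancherel g (ξ / (2 * Real.pi))) volume := by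
  have hg := (memLp_plancherel g).1
  exact ⟨fun ξ => hg.mk _ (ξ / (2 * Real.pi)),
    hg.stronglyMeasurable_mk.comp_measurable (by fun_prop),
    ae_eq_comp_div hg.ae_eq_mk two_pi_ne_zero⟩

theorem continuous_fourier_of_integrable {f : ℝ → ℂ} (hf : Integrable f) : Continuous (𝓕 f) :=
  VectorFourier.fourierIntegral_continuous (L := innerₗ ℝ) Real.continuous_fourierChar
    (by exact continuous_inner) hf

theorem enorm_fourier_le_eLpNorm (f : ℝ → ℂ) (ξ : ℝ) : ‖𝓕 f ξ‖ₑ ≤ eLpNorm f 1 volume := by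
  rw [Real.fourier_real_eq_integral_exp_smul, eLpNorm_one_eq_lintegral_enorm]
  refine (enorm_integral_le_lintegral_enorm _).trans_eq (lintegral_congr fun x => ?_)
  rw [enorm_smul, ← ofReal_norm (Complex.exp _), Complex.norm_exp_ofReal_mul_I]
  simp

theorem aestronglyMeasurable_fourierHat {p : ℝ≥0∞} (hp : 1 ≤ p) (hp2 : p ≤ 2) {f : ℝ → ℂ}
    (hf : MemLp f p volume) : AEStronglyMeasurable (fourierHat f) volume := by
  have hL := integrable_largePart hp (ne_top_of_le_ne_top (by simp) hp2) hf
  rw [fourierHat_of_decomposition]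
  refine AEStronglyMeasurable.add ?_ (aestronglyMeasurable_plancherel_comp_div _)
  exact ((continuous_fourier_of_integrable hL).comp (by fun_prop)).aestronglyMeasurable

/-- The transform of the large part is bounded, so it is paired with the damping in `L¹`; the small
part is handled by Plancherel and Cauchy–Schwarz. The factor `(2π)^{1/2}` comes from rescaling the
frequency. -/
theorem eLpNorm_fourierHat_mul_damping_le {p : ℝ≥0∞} (hp : 1 ≤ p) (hp2 : p ≤ 2) (ha : 0 < a)
    {f : ℝ → ℂ} (hf : MemLp f p volume) :
    eLpNorm (fun ξ => fourierHat f ξ * (damping a γ t ξ : ℂ)) 1 volume ≤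
      eLpNorm (largePart f) 1 volume * eLpNorm (fun ξ => (damping a γ t ξ : ℂ)) 1 volume +
      ENNReal.ofReal (2 * Real.pi) ^ (1 / 2 : ℝ) * eLpNorm (smallPart f) 2 volume *
        eLpNorm (fun ξ => (damping a γ t ξ : ℂ)) 2 volume := by
  have hL := integrable_largePart hp (ne_top_of_le_ne_top (by simp) hp2) hf
  have hS := memLp_smallPart hp hp2 hf
  have hd : AEStronglyMeasurable (fun ξ => (damping a γ t ξ : ℂ)) volume :=
    (Complex.continuous_ofReal.comp (continuous_damping ha)).aestronglyMeasurable
  have hA : AEStronglyMeasurable (fun ξ => 𝓕 (largePart f) (ξ / (2 * Real.pi))) volume :=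
    ((continuous_fourier_of_integrable hL).comp (by fun_prop)).aestronglyMeasurable
  have hB := aestronglyMeasurable_plancherel_comp_div (smallPart f)
  have e : (fun ξ => fourierHat f ξ * (damping a γ t ξ : ℂ)) =
      (fun ξ => 𝓕 (largePart f) (ξ / (2 * Real.pi)) * (damping a γ t ξ : ℂ)) +
      (fun ξ => plancherel (smallPart f) (ξ / (2 * Real.pi))) •
        (fun ξ => (damping a γ t ξ : ℂ)) := by
    funext ξ
    rw [fourierHat_of_decomposition]
    exact add_mul _ _ _
  rw [e]
  refine (eLpNorm_add_le (hA.mul hd) (hB.smul hd) le_rfl).trans (add_le_add ?_ ?_)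
  · rw [eLpNorm_one_eq_lintegral_enorm,
      eLpNorm_one_eq_lintegral_enorm (f := fun ξ => (damping a γ t ξ : ℂ)),
      ← lintegral_const_mul'' _ hd.enorm]
    refine lintegral_mono fun ξ => ?_
    rw [Pi.mul_apply, enorm_mul]
    gcongr
    exact enorm_fourier_le_eLpNorm _ _
  · refine (eLpNorm_smul_le_mul_eLpNorm (p := 2) (q := 2) hd hB).trans_eq ?_
    rw [eLpNorm_comp_div_two_pi (memLp_plancherel _).1, eLpNorm_plancherel hS]

theorem integrable_fourierHat_mul_damping {p : ℝ≥0∞} (hp : 1 ≤ p) (hp2 : p ≤ 2) (ha : 0 < a)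
    (ht : 0 < t) {f : ℝ → ℂ} (hf : MemLp f p volume) :
    Integrable fun ξ => fourierHat f ξ * (damping a γ t ξ : ℂ) := by
  have hL := integrable_largePart hp (ne_top_of_le_ne_top (by simp) hp2) hf
  have hS := memLp_smallPart hp hp2 hf
  have hd : AEStronglyMeasurable (fun ξ => (damping a γ t ξ : ℂ)) volume :=
    (Complex.continuous_ofReal.comp (continuous_damping ha)).aestronglyMeasurable
  rw [← memLp_one_iff_integrable]
  refine ⟨(aestronglyMeasurable_fourierHat hp hp2 hf).mul hd,
    (eLpNorm_fourierHat_mul_damping_le hp hp2 ha hf).trans_lt ?_⟩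
  refine ENNReal.add_lt_top.2 ⟨ENNReal.mul_lt_top (memLp_one_iff_integrable.2 hL).2
    (memLp_damping_one ha ht).2, ENNReal.mul_lt_top (ENNReal.mul_lt_top ?_ hS.2)
    (memLp_damping_two ha ht).2⟩
  exact ENNReal.rpow_lt_top_of_nonneg (by norm_num) ENNReal.ofReal_ne_top

theorem integrable_landau_integrand {p : ℝ≥0∞} (hp : 1 ≤ p) (hp2 : p ≤ 2) (ha : 0 < a)
    (ht : 0 < t) {f : ℝ → ℂ} (hf : MemLp f p volume) (x : ℝ) :
    Integrable fun ξ : ℝ =>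
      fourierHat f ξ * (Complex.exp (Complex.I * x * ξ) * multiplier a γ t ξ) := by
  refine (integrable_fourierHat_mul_damping (γ := γ) hp hp2 ha ht hf).mono ?_
    (Eventually.of_forall fun ξ => ?_)
  · refine (aestronglyMeasurable_fourierHat hp hp2 hf).mul (Continuous.aestronglyMeasurable ?_)
    have := continuous_multiplier (γ := γ) (t := t) ha
    fun_prop
  · rw [norm_mul, norm_mul, norm_mul, norm_exp_I_mul_mul, norm_multiplier, Complex.norm_real,
      Real.norm_of_nonneg (damping_pos ξ).le, one_mul]

theorem landau_add {p : ℝ≥0∞} (hp : 1 ≤ p) (hp2 : p ≤ 2) (ha : 0 < a) (ht : 0 < t) {f g : ℝ → ℂ}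
    (hf : MemLp f p volume) (hg : MemLp g p volume) (x : ℝ) :
    landau a γ t (f + g) x = landau a γ t f x + landau a γ t g x := by
  rw [landau_eq, landau_eq, landau_eq, ← mul_add,
    ← integral_add (integrable_landau_integrand hp hp2 ha ht hf x)
      (integrable_landau_integrand hp hp2 ha ht hg x)]
  congr 1
  refine integral_congr_ae ?_
  filter_upwards [fourierHat_add hp hp2 hf hg] with ξ hξ
  rw [hξ, Pi.add_apply, add_mul]

theorem landau_const_smul {p : ℝ≥0∞} (hp : 1 ≤ p) (hp2 : p ≤ 2) {f : ℝ → ℂ} (c : ℂ)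
    (hf : MemLp f p volume) (x : ℝ) :
    landau a γ t (c • f) x = c * landau a γ t f x := by
  rw [landau_eq, landau_eq, mul_left_comm c, ← integral_const_mul c]
  congr 1
  refine integral_congr_ae ?_
  filter_upwards [fourierHat_const_smul hp hp2 c hf] with ξ hξ
  rw [hξ, Pi.smul_apply, smul_eq_mul, mul_assoc]

theorem landau_congr {p : ℝ≥0∞} (hp : 1 ≤ p) (hp2 : p ≤ 2) {f g : ℝ → ℂ}
    (hf : MemLp f p volume) (h : f =ᵐ[volume] g) (x : ℝ) :
    landau a γ t f x = landau a γ t g x := by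
  rw [landau_eq, landau_eq]
  congr 1
  refine integral_congr_ae ?_
  filter_upwards [fourierHat_congr hp hp2 hf h] with ξ hξ
  rw [hξ]

/-- `P^t` maps `L^p` into `L^∞`, uniformly for `t` bounded away from zero. -/
theorem exists_norm_landau_le {p : ℝ≥0∞} (hp : 1 ≤ p) (hp2 : p ≤ 2) (ha : 0 < a) (hγ : 0 ≤ γ)
    {τ : ℝ} (hτ : 0 < τ) :
    ∃ K : ℝ, 0 < K ∧ ∀ f : ℝ → ℂ, MemLp f p volume → eLpNorm f p volume ≤ 1 →
      ∀ t, τ ≤ t → ∀ x, ‖landau a γ t f x‖ ≤ K := by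
  -- The damping decreases in time, so its norms at time `τ` serve for all later times.
  set K : ℝ≥0∞ := eLpNorm (fun ξ => (damping a γ τ ξ : ℂ)) 1 volume +
      ENNReal.ofReal (2 * Real.pi) ^ (1 / 2 : ℝ) *
        eLpNorm (fun ξ => (damping a γ τ ξ : ℂ)) 2 volume with hK
  have hKt : K ≠ ∞ := (ENNReal.add_lt_top.2 ⟨(memLp_damping_one ha hτ).2,
    ENNReal.mul_lt_top (ENNReal.rpow_lt_top_of_nonneg (by norm_num) ENNReal.ofReal_ne_top)
      (memLp_damping_two ha hτ).2⟩).ne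
  refine ⟨K.toReal + 1, by positivity, fun f hf hf1 t ht x => ?_⟩
  have hpt : p ≠ ∞ := ne_top_of_le_ne_top (by simp) hp2
  have h1 : eLpNorm (fun ξ => fourierHat f ξ * (damping a γ τ ξ : ℂ)) 1 volume ≤ K := by
    refine (eLpNorm_fourierHat_mul_damping_le hp hp2 ha hf).trans ?_
    rw [hK]
    have hl := eLpNorm_largePart_le_one hp hpt hf1
    have hs := eLpNorm_smallPart_le_one hp hp2 hf1
    refine add_le_add (mul_le_of_le_one_left (by positivity) hl) ?_
    gcongr
    exact mul_le_of_le_one_right (by positivity) hs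
  have h2 : ‖∫ ξ : ℝ, fourierHat f ξ * (Complex.exp (Complex.I * x * ξ) * multiplier a γ t ξ)‖ₑ
      ≤ K := by
    refine (enorm_integral_le_lintegral_enorm _).trans (le_trans ?_ h1)
    rw [eLpNorm_one_eq_lintegral_enorm]
    refine lintegral_mono fun ξ => enorm_le_iff_norm_le.2 ?_
    rw [norm_mul, norm_mul, norm_mul, norm_exp_I_mul_mul, norm_multiplier, Complex.norm_real,
      Real.norm_of_nonneg (damping_pos ξ).le, one_mul]
    gcongr
    exact damping_anti hγ hτ.le ht ξ
  have h3 : ‖∫ ξ : ℝ, fourierHat f ξ * (Complex.exp (Complex.I * x * ξ) * multiplier a γ t ξ)‖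
      ≤ K.toReal := by
    rw [← toReal_enorm]
    exact ENNReal.toReal_mono hKt h2
  have h4 : ‖(1 / (2 * Real.pi) : ℂ)‖ ≤ 1 := by
    rw [norm_div, norm_mul, norm_one, Complex.norm_ofNat, Complex.norm_real,
      Real.norm_of_nonneg Real.pi_pos.le, div_le_one Real.two_pi_pos]
    linarith [Real.pi_gt_three]
  rw [landau_eq, norm_mul]
  calc _ ≤ 1 * K.toReal := by gcongr
    _ ≤ _ := by linarith

/-- If the Fourier transform of `f` is integrable then `P^t f` is bounded uniformly in `t`. -/
theorem exists_norm_landau_le_of_integrable_fourier {p : ℝ≥0∞} (hp : 1 ≤ p) (hp2 : p ≤ 2)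
    {f : ℝ → ℂ} (hf : MemLp f p volume) (hf1 : Integrable f) (hF : Integrable (𝓕 f)) :
    ∃ D : ℝ, ∀ t, 0 < t → ∀ x, ‖landau a γ t f x‖ ≤ D := by
  have hF' : Integrable fun ξ => 𝓕 f (ξ / (2 * Real.pi)) := hF.comp_div two_pi_ne_zero
  refine ⟨‖(1 / (2 * Real.pi) : ℂ)‖ * ∫ ξ, ‖𝓕 f (ξ / (2 * Real.pi))‖, fun t ht x => ?_⟩
  rw [landau_eq, norm_mul]
  gcongr
  refine norm_integral_le_of_norm_le hF'.norm ?_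
  filter_upwards [fourierHat_of_integrable hp hp2 hf hf1] with ξ hξ
  rw [hξ, norm_mul, norm_mul, norm_exp_I_mul_mul, norm_multiplier, one_mul]
  exact mul_le_of_le_one_right (norm_nonneg _) (damping_le_one ht.le ξ)

end

/-! ### The Baire category argument -/

/-- The functions in `L^p` whose maximal function over times in `(0, 1/(n+1)]` exceeds `n` at every
point of `[0,1]`, with some uniformity. -/
def largeMaximal (a γ : ℝ) (p : ℝ≥0∞) (n : ℕ) : Set (Lp ℂ p (volume : Measure ℝ)) :=
  {f | ∃ τ > (0 : ℝ), ∃ δ > (0 : ℝ), ∀ x ∈ Set.Icc (0 : ℝ) 1, ∃ t, τ ≤ t ∧ t ≤ 1 / (n + 1 : ℝ) ∧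
    n + δ ≤ ‖landau a γ t f x‖}

section
variable {a γ : ℝ} {p : ℝ≥0∞}

theorem landau_lp_add (hp : 1 ≤ p) (hp2 : p ≤ 2) (ha : 0 < a) {t : ℝ} (ht : 0 < t)
    (f g : Lp ℂ p (volume : Measure ℝ)) (x : ℝ) :
    landau a γ t (f + g : Lp ℂ p (volume : Measure ℝ)) x =
      landau a γ t f x + landau a γ t g x := by
  rw [landau_congr hp hp2 (Lp.memLp _) (Lp.coeFn_add f g) x,
    landau_add hp hp2 ha ht (Lp.memLp f) (Lp.memLp g)]

theorem landau_lp_smul (hp : 1 ≤ p) (hp2 : p ≤ 2) {t : ℝ} (c : ℂ)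
    (f : Lp ℂ p (volume : Measure ℝ)) (x : ℝ) :
    landau a γ t (c • f : Lp ℂ p (volume : Measure ℝ)) x = c * landau a γ t f x := by
  rw [landau_congr hp hp2 (Lp.memLp _) (Lp.coeFn_smul c f) x,
    landau_const_smul hp hp2 c (Lp.memLp f)]

variable [Fact (1 ≤ p)]

theorem exists_norm_landau_lp_le (hp2 : p ≤ 2) (ha : 0 < a) (hγ : 0 ≤ γ) {τ : ℝ} (hτ : 0 < τ) :
    ∃ K : ℝ, 0 < K ∧ ∀ f : Lp ℂ p (volume : Measure ℝ), ∀ t, τ ≤ t → ∀ x,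
      ‖landau a γ t f x‖ ≤ K * ‖f‖ := by
  have hp : 1 ≤ p := Fact.out
  obtain ⟨K, hK, h⟩ := exists_norm_landau_le (p := p) hp hp2 ha hγ hτ
  refine ⟨K, hK, fun f t ht x => ?_⟩
  refine le_of_forall_pos_le_add fun ε hε => ?_
  -- Rescaling into the unit ball; the extra `ε / K` keeps `r` positive when `f = 0`.
  set r := ‖f‖ + ε / K with hr
  have hr0 : 0 < r := by positivity
  have e : f = (r : ℂ) • ((r⁻¹ : ℝ) : ℂ) • f := by
    rw [smul_smul, ← Complex.ofReal_mul, mul_inv_cancel₀ hr0.ne', Complex.ofReal_one, one_smul]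
  have hle : ‖((r⁻¹ : ℝ) : ℂ) • f‖ ≤ 1 := by
    rw [norm_smul, Complex.norm_real, Real.norm_of_nonneg (by positivity), inv_mul_le_one₀ hr0, hr]
    have : 0 < ε / K := by positivity
    linarith
  have h1 : eLpNorm (((r⁻¹ : ℝ) : ℂ) • f : Lp ℂ p (volume : Measure ℝ)) p volume ≤ 1 := by
    rw [← Lp.enorm_def, ← ofReal_norm, ENNReal.ofReal_le_one]
    exact hle
  have h2 := h _ (Lp.memLp _) h1 t ht x
  rw [e, landau_lp_smul hp hp2, norm_mul, Complex.norm_real, Real.norm_of_nonneg hr0.le, ← e]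
  calc r * _ ≤ r * K := by gcongr
    _ = K * ‖f‖ + ε := by
      rw [hr]
      field_simp

/-- The lower bound `τ` on the times makes all the `P^t` involved uniformly Lipschitz from `L^p` to
`L^∞`, so a small perturbation costs at most half of the margin `δ`. -/
theorem isOpen_largeMaximal (hp2 : p ≤ 2) (ha : 0 < a) (hγ : 0 ≤ γ) (n : ℕ) :
    IsOpen (largeMaximal a γ p n) := by
  have hp : 1 ≤ p := Fact.out
  rw [Metric.isOpen_iff]
  rintro f ⟨τ, hτ, δ, hδ, hf⟩
  obtain ⟨K, hK, h⟩ := exists_norm_landau_lp_le (p := p) hp2 ha hγ hτ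
  refine ⟨δ / 2 / K, by positivity, fun g hg => ⟨τ, hτ, δ / 2, by positivity, fun x hx => ?_⟩⟩
  obtain ⟨t, ht, ht', hn⟩ := hf x hx
  refine ⟨t, ht, ht', ?_⟩
  have e : f = g + (f - g) := by abel
  have h1 : ‖landau a γ t (f - g : Lp ℂ p (volume : Measure ℝ)) x‖ ≤ δ / 2 := by
    refine (h _ t ht x).trans ?_
    rw [Metric.mem_ball, dist_comm, dist_eq_norm, lt_div_iff₀ hK] at hg
    linarith
  rw [e, landau_lp_add hp hp2 ha (hτ.trans_le ht)] at hn
  have := norm_add_le (landau a γ t g x) (landau a γ t (f - g : Lp ℂ p (volume : Measure ℝ)) x)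
  linarith

/-- The existence of small functions with large maximal function. -/
def HasLargeMaximalFunction (a γ : ℝ) (p : ℝ≥0∞) : Prop :=
  ∀ η > (0 : ℝ), ∃ f : ℝ → ℂ, MemLp f p volume ∧ eLpNorm f p volume ≤ ENNReal.ofReal η ∧
    ∃ τ > (0 : ℝ), ∀ x ∈ Set.Icc (0 : ℝ) 1, ∃ t, τ ≤ t ∧ t ≤ η ∧ 1 / 4 ≤ ‖landau a γ t f x‖

/-- A Schwartz function near `f` has an evolution bounded uniformly in time, which a large multiple
of a much smaller function with large maximal function overwhelms. -/
theorem dense_largeMaximal (hp2 : p ≤ 2) (ha : 0 < a)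
    (H : HasLargeMaximalFunction a γ p) (n : ℕ) : Dense (largeMaximal a γ p n) := by
  have hp : 1 ≤ p := Fact.out
  have hpt : p ≠ ∞ := ne_top_of_le_ne_top (by simp) hp2
  rw [Metric.dense_iff]
  intro f ε hε
  obtain ⟨φ, hφ⟩ := (SchwartzMap.denseRange_toLpCLM (E := ℝ) (F := ℂ) (p := p)
    (μ := volume) hpt).exists_dist_lt f (half_pos hε)
  set g : Lp ℂ p (volume : Measure ℝ) := φ.toLp p volume with hg
  have hgφ : (g : ℝ → ℂ) =ᵐ[volume] φ := φ.coeFn_toLp p volume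
  have hφF : Integrable (𝓕 (φ : ℝ → ℂ)) := (𝓕 φ).integrable
  obtain ⟨D, hD⟩ := exists_norm_landau_le_of_integrable_fourier (a := a) (γ := γ) hp hp2
    (φ.memLp p volume) φ.integrable hφF
  have hD' : ∀ t, 0 < t → ∀ x, ‖landau a γ t g x‖ ≤ D := fun t ht x => by
    rw [landau_congr hp hp2 (Lp.memLp g) hgφ]
    exact hD t ht x
  have hD0 : 0 ≤ D := (norm_nonneg _).trans (hD 1 one_pos 0)
  -- The 4 cancels the lower bound 1/4, `D` absorbs the evolution of `g`, and the 1 becomes the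
  -- margin `δ`.
  set A : ℝ := 4 * (n + 1 + D) with hA
  have hA0 : 0 < A := by positivity
  obtain ⟨u, hu, huη, τ, hτ, hmax⟩ := H (min (1 / (n + 1 : ℝ)) (ε / 4 / A)) (by positivity)
  set U : Lp ℂ p (volume : Measure ℝ) := hu.toLp u with hU
  have hUn : ‖U‖ ≤ ε / 4 / A := by
    rw [hU, Lp.norm_toLp]
    refine (ENNReal.toReal_mono ENNReal.ofReal_ne_top huη).trans ?_
    rw [ENNReal.toReal_ofReal (by positivity)]
    exact min_le_right _ _
  refine ⟨g + (A : ℂ) • U, ?_, τ, hτ, 1, one_pos, fun x hx => ?_⟩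
  · rw [Metric.mem_ball]
    have h1 : dist (g + (A : ℂ) • U) g ≤ ε / 4 := by
      rw [dist_eq_norm, add_sub_cancel_left, norm_smul, Complex.norm_real,
        Real.norm_of_nonneg hA0.le]
      calc A * ‖U‖ ≤ A * (ε / 4 / A) := by gcongr
        _ = ε / 4 := by field_simp
    have h2 : dist f g < ε / 2 := hφ
    have h3 := dist_triangle (g + (A : ℂ) • U) g f
    rw [dist_comm g f] at h3
    linarith
  · obtain ⟨t, ht, ht', hl⟩ := hmax x hx
    refine ⟨t, ht, ht'.trans (min_le_left _ _), ?_⟩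
    have ht0 := hτ.trans_le ht
    rw [landau_lp_add hp hp2 ha ht0, landau_lp_smul hp hp2,
      landau_congr hp hp2 (Lp.memLp U) hu.coeFn_toLp]
    have h1 := hD' t ht0 x
    have h2 : n + 1 + D ≤ ‖(A : ℂ) * landau a γ t u x‖ := by
      rw [norm_mul, Complex.norm_real, Real.norm_of_nonneg hA0.le]
      calc (n + 1 + D : ℝ) = A * (1 / 4) := by rw [hA]; ring
        _ ≤ _ := by gcongr
    have h3 := norm_sub_norm_le ((A : ℂ) * landau a γ t u x) (-landau a γ t g x)
    rw [norm_neg, sub_neg_eq_add, add_comm _ (landau a γ t g x)] at h3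
    linarith

theorem exists_forall_not_tendsto (hp2 : p ≤ 2) (ha : 0 < a) (hγ : 0 ≤ γ)
    (H : HasLargeMaximalFunction a γ p) :
    ∃ f : ℝ → ℂ, MemLp f p volume ∧ ∀ x ∈ Set.Icc (0 : ℝ) 1, ∀ z : ℂ,
      ¬ Tendsto (fun t : ℝ => landau a γ t f x) (𝓝[>] 0) (𝓝 z) := by
  obtain ⟨f, hf⟩ := (dense_iInter_of_isOpen_nat (fun n => isOpen_largeMaximal (p := p) hp2 ha hγ n)
    (fun n => dense_largeMaximal hp2 ha H n)).nonempty
  rw [Set.mem_iInter] at hf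
  refine ⟨f, Lp.memLp f, fun x hx z hz => ?_⟩
  have h1 : ∀ᶠ t in 𝓝[>] (0 : ℝ), ‖landau a γ t f x‖ < ‖z‖ + 1 :=
    hz.norm.eventually_lt_const (by linarith)
  obtain ⟨b, hb, h2⟩ := mem_nhdsGT_iff_exists_Ioo_subset.1 h1
  -- A limit would bound the evolution by `‖z‖ + 1` on `(0, b)`; this `n` exceeds that bound and has
  -- `1/(n+1) < b`.
  obtain ⟨n, hn⟩ := exists_nat_ge (max (‖z‖ + 1) (1 / b))
  obtain ⟨τ, hτ, δ, hδ, h3⟩ := hf n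
  obtain ⟨t, ht, ht', h4⟩ := h3 x hx
  have hb0 : (0 : ℝ) < b := hb
  have htb : t < b := by
    refine ht'.trans_lt ?_
    rw [one_div_lt (by positivity) hb0]
    linarith [le_max_right (‖z‖ + 1) (1 / b)]
  have h5 : ‖landau a γ t f x‖ < ‖z‖ + 1 := h2 ⟨hτ.trans_le ht, htb⟩
  linarith [le_max_left (‖z‖ + 1) (1 / b)]

end

/-! ### Gaussian wave packets -/

theorem integral_gaussian_mul_exp (s : ℝ) :
    ∫ x : ℝ, (Real.exp (-x ^ 2 / 2) : ℂ) * Complex.exp (Complex.I * s * x) =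
      (Real.sqrt (2 * Real.pi) * Real.exp (-s ^ 2 / 2) : ℝ) := by
  have h := fourierIntegral_gaussian (b := 1 / 2) (by norm_num) (s : ℂ)
  have e : (Real.pi / (1 / 2) : ℂ) ^ (1 / 2 : ℂ) = (Real.sqrt (2 * Real.pi) : ℝ) := by
    rw [Real.sqrt_eq_rpow, Complex.ofReal_cpow (by positivity)]
    push_cast
    congr 1
    ring
  rw [e] at h
  push_cast
  calc _ = _ := by
        refine integral_congr_ae (Eventually.of_forall fun x => ?_)
        simp only
        rw [mul_comm]
        congr 2
        ring
    _ = _ := h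
    _ = _ := by
        congr 2
        ring

theorem integrable_gaussian : Integrable fun x : ℝ => Real.exp (-x ^ 2 / 2) := by
  refine (integrable_exp_neg_mul_sq (b := 1 / 2) (by norm_num)).congr
    (Eventually.of_forall fun x => ?_)
  simp only
  congr 1
  ring

theorem integral_gaussian_half : ∫ x : ℝ, Real.exp (-x ^ 2 / 2) = Real.sqrt (2 * Real.pi) := by
  rw [← Complex.ofReal_inj, ← integral_complex_ofReal]
  simpa using integral_gaussian_mul_exp 0

theorem integrable_gaussian_mul {g : ℝ → ℂ} {C : ℝ} (hg : Continuous g) (hb : ∀ x, ‖g x‖ ≤ C) :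
    Integrable fun x : ℝ => (Real.exp (-x ^ 2 / 2) : ℂ) * g x :=
  integrable_gaussian.ofReal.mul_bdd (c := C) hg.aestronglyMeasurable (Eventually.of_forall hb)

/-- The Gaussian wave packet of frequency `l` centred at the origin. -/
noncomputable def wavePacket (l x : ℝ) : ℂ :=
  (Real.exp (-x ^ 2 / 2) : ℂ) * Complex.exp (Complex.I * l * x)

theorem continuous_wavePacket (l : ℝ) : Continuous (wavePacket l) := by
  unfold wavePacket
  fun_prop

theorem integrable_wavePacket (l : ℝ) : Integrable (wavePacket l) :=
  integrable_gaussian_mul (C := 1) (by fun_prop) fun x => (norm_exp_I_mul_mul l x).le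

theorem norm_wavePacket (l x : ℝ) : ‖wavePacket l x‖ = Real.exp (-x ^ 2 / 2) := by
  rw [wavePacket, norm_mul, norm_exp_I_mul_mul, mul_one, Complex.norm_real,
    Real.norm_of_nonneg (Real.exp_pos _).le]

theorem memLp_wavePacket {p : ℝ≥0∞} (hp : 1 ≤ p) (l : ℝ) : MemLp (wavePacket l) p volume := by
  by_cases hpt : p = ∞
  · rw [hpt]
    refine memLp_top_of_bound (continuous_wavePacket l).aestronglyMeasurable 1
      (Eventually.of_forall fun x => ?_)
    rw [norm_wavePacket, Real.exp_le_one_iff]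
    nlinarith [sq_nonneg x]
  have h0 : 0 < p.toReal := ENNReal.toReal_pos (by positivity) hpt
  rw [← integrable_norm_rpow_iff (continuous_wavePacket l).aestronglyMeasurable
    (by positivity) hpt]
  refine (integrable_exp_neg_mul_sq (b := p.toReal / 2) (by positivity)).congr
    (Eventually.of_forall fun x => ?_)
  simp only [norm_wavePacket, ← Real.exp_mul]
  congr 1
  ring

theorem fourierHat_wavePacket (l : ℝ) :
    fourierHat (wavePacket l) =ᵐ[volume] fun ξ =>
      ((Real.sqrt (2 * Real.pi) * Real.exp (-(ξ - l) ^ 2 / 2) : ℝ) : ℂ) := by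
  filter_upwards [fourierHat_of_integrable le_rfl (by norm_num)
    (memLp_one_iff_integrable.2 (integrable_wavePacket l)) (integrable_wavePacket l)] with ξ hξ
  rw [hξ, ← integral_mul_exp_eq_fourier, ← neg_sub l ξ, neg_sq, ← integral_gaussian_mul_exp]
  refine integral_congr_ae (Eventually.of_forall fun x => ?_)
  simp only [wavePacket]
  rw [mul_assoc, ← Complex.exp_add]
  congr 2
  push_cast
  ring

theorem landau_wavePacket (a γ t l x : ℝ) :
    landau a γ t (wavePacket l) x = (1 / Real.sqrt (2 * Real.pi) : ℝ) *
      (Complex.exp (Complex.I * l * x) * ∫ η : ℝ, (Real.exp (-η ^ 2 / 2) : ℂ) *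
        (Complex.exp (Complex.I * x * η) * multiplier a γ t (η + l))) := by
  have hs : Real.sqrt (2 * Real.pi) * Real.sqrt (2 * Real.pi) = 2 * Real.pi :=
    Real.mul_self_sqrt (by positivity)
  have hs0 : Real.sqrt (2 * Real.pi) ≠ 0 := by positivity
  have e1 : ∫ ξ : ℝ, fourierHat (wavePacket l) ξ *
      (Complex.exp (Complex.I * x * ξ) * multiplier a γ t ξ) =
      ∫ ξ : ℝ, ((Real.sqrt (2 * Real.pi) * Real.exp (-(ξ - l) ^ 2 / 2) : ℝ) : ℂ) *
        (Complex.exp (Complex.I * x * ξ) * multiplier a γ t ξ) := by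
    refine integral_congr_ae ?_
    filter_upwards [fourierHat_wavePacket l] with ξ hξ
    rw [hξ]
  rw [landau_eq, e1, ← integral_add_right_eq_self _ l, ← integral_const_mul,
    ← integral_const_mul, ← integral_const_mul]
  refine integral_congr_ae (Eventually.of_forall fun η => ?_)
  simp only [add_sub_cancel_right]
  have e2 : Complex.exp (Complex.I * x * ((η + l : ℝ) : ℂ)) =
      Complex.exp (Complex.I * l * x) * Complex.exp (Complex.I * x * η) := by
    rw [← Complex.exp_add]
    congr 1
    push_cast
    ring
  have e3 : (1 / (2 * Real.pi) : ℂ) =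
      (1 / Real.sqrt (2 * Real.pi) : ℝ) * (1 / Real.sqrt (2 * Real.pi) : ℝ) := by
    rw [← Complex.ofReal_mul, div_mul_div_comm, hs]
    push_cast
    ring
  have e4 : ((1 / Real.sqrt (2 * Real.pi) : ℝ) : ℂ) * (Real.sqrt (2 * Real.pi) : ℝ) = 1 := by
    rw [← Complex.ofReal_mul, one_div_mul_cancel hs0, Complex.ofReal_one]
  rw [e2, e3, Complex.ofReal_mul]
  linear_combination ((1 / Real.sqrt (2 * Real.pi) : ℝ) : ℂ) * (Real.exp (-η ^ 2 / 2) : ℂ) *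
    Complex.exp (Complex.I * l * x) * Complex.exp (Complex.I * x * η) *
      multiplier a γ t (η + l) * e4

theorem norm_exp_I_mul (θ : ℝ) : ‖Complex.exp (Complex.I * θ)‖ = 1 := by
  rw [mul_comm, Complex.norm_exp_ofReal_mul_I]

theorem norm_exp_I_mul_sub_exp_I_mul_le (α θ : ℝ) :
    ‖Complex.exp (Complex.I * α) - Complex.exp (Complex.I * θ)‖ ≤ |α - θ| := by
  have e : Complex.exp (Complex.I * α) - Complex.exp (Complex.I * θ) =
      Complex.exp (Complex.I * θ) * (Complex.exp (Complex.I * (α - θ : ℝ)) - 1) := by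
    rw [mul_sub, ← Complex.exp_add, mul_one]
    congr 2
    push_cast
    ring
  rw [e, norm_mul, norm_exp_I_mul, one_mul]
  exact Real.norm_exp_I_mul_ofReal_sub_one_le

/-- The multiplier is close to `e^{iθ}` where its phase is close to `θ` and the damping is weak. -/
theorem norm_multiplier_sub_le {a γ t : ℝ} (ht : 0 ≤ t) (ξ θ : ℝ) :
    ‖multiplier a γ t ξ - Complex.exp (Complex.I * θ)‖ ≤
      min 2 (|t * |ξ| ^ a - θ| + t ^ γ * |ξ| ^ a) := by
  refine le_min ?_ ?_
  · refine (norm_sub_le _ _).trans ?_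
    rw [norm_multiplier, norm_exp_I_mul]
    linarith [damping_le_one (a := a) (γ := γ) ht ξ]
  · have e : multiplier a γ t ξ - Complex.exp (Complex.I * θ) =
        (Complex.exp (Complex.I * (t * |ξ| ^ a : ℝ)) - Complex.exp (Complex.I * θ)) -
        Complex.exp (Complex.I * (t * |ξ| ^ a : ℝ)) * ((1 - damping a γ t ξ : ℝ) : ℂ) := by
      rw [multiplier]
      push_cast
      ring_nf
    rw [e]
    refine (norm_sub_le _ _).trans (add_le_add (norm_exp_I_mul_sub_exp_I_mul_le _ _) ?_)
    rw [norm_mul, norm_exp_I_mul, one_mul, Complex.norm_real,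
      Real.norm_of_nonneg (sub_nonneg.2 (damping_le_one ht ξ)), damping]
    linarith [Real.add_one_le_exp (-(t ^ γ * |ξ| ^ a))]

/-- If the multiplier were the constant `e^{iθ}`, Gaussian inversion would return the packet times
that phase; the error is the Gaussian average of the difference. The cap at 2 provides an integrable
majorant later. -/
theorem norm_landau_wavePacket_sub_le {a γ t : ℝ} (ha : 0 < a) (ht : 0 ≤ t) (l x θ : ℝ) :
    ‖landau a γ t (wavePacket l) x - Complex.exp (Complex.I * l * x) *
      Complex.exp (Complex.I * θ) * (Real.exp (-x ^ 2 / 2) : ℂ)‖ ≤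
    ∫ η : ℝ, Real.exp (-η ^ 2 / 2) *
      min 2 (|t * |η + l| ^ a - θ| + t ^ γ * |η + l| ^ a) := by
  have hs0 : Real.sqrt (2 * Real.pi) ≠ 0 := by positivity
  have hs1 : 1 ≤ Real.sqrt (2 * Real.pi) := by
    rw [Real.one_le_sqrt]
    linarith [Real.pi_gt_three]
  have hm := continuous_multiplier (γ := γ) (t := t) ha
  have hr : Continuous fun η : ℝ => |η + l| ^ a :=
    (continuous_id.add continuous_const).abs.rpow_const fun _ => Or.inr ha.le
  have e1 : (Real.exp (-x ^ 2 / 2) : ℂ) = (1 / Real.sqrt (2 * Real.pi) : ℝ) *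
      ∫ η : ℝ, (Real.exp (-η ^ 2 / 2) : ℂ) * Complex.exp (Complex.I * x * η) := by
    rw [integral_gaussian_mul_exp, ← Complex.ofReal_mul, ← mul_assoc, one_div_mul_cancel hs0,
      one_mul]
  have i1 : Integrable fun η : ℝ => (Real.exp (-η ^ 2 / 2) : ℂ) *
      (Complex.exp (Complex.I * x * η) * multiplier a γ t (η + l)) := by
    refine integrable_gaussian_mul (C := 1) (by fun_prop) fun η => ?_
    rw [norm_mul, norm_exp_I_mul_mul, norm_multiplier, one_mul]
    exact damping_le_one ht _
  have i2 : Integrable fun η : ℝ => (Real.exp (-η ^ 2 / 2) : ℂ) * Complex.exp (Complex.I * x * η) :=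
    integrable_gaussian_mul (C := 1) (by fun_prop) fun η => (norm_exp_I_mul_mul x η).le
  have e2 : landau a γ t (wavePacket l) x - Complex.exp (Complex.I * l * x) *
      Complex.exp (Complex.I * θ) * (Real.exp (-x ^ 2 / 2) : ℂ) =
      (1 / Real.sqrt (2 * Real.pi) : ℝ) * (Complex.exp (Complex.I * l * x) *
        ∫ η : ℝ, (Real.exp (-η ^ 2 / 2) : ℂ) * (Complex.exp (Complex.I * x * η) *
          (multiplier a γ t (η + l) - Complex.exp (Complex.I * θ)))) := by
    have : ∫ η : ℝ, (Real.exp (-η ^ 2 / 2) : ℂ) * (Complex.exp (Complex.I * x * η) *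
          (multiplier a γ t (η + l) - Complex.exp (Complex.I * θ))) =
        (∫ η : ℝ, (Real.exp (-η ^ 2 / 2) : ℂ) *
          (Complex.exp (Complex.I * x * η) * multiplier a γ t (η + l))) -
        Complex.exp (Complex.I * θ) *
          ∫ η : ℝ, (Real.exp (-η ^ 2 / 2) : ℂ) * Complex.exp (Complex.I * x * η) := by
      rw [← integral_const_mul, ← integral_sub i1 (i2.const_mul _)]
      refine integral_congr_ae (Eventually.of_forall fun η => ?_)
      simp only
      ring
    rw [this, landau_wavePacket, e1]
    ring
  have hn : ‖((1 / Real.sqrt (2 * Real.pi) : ℝ) : ℂ)‖ ≤ 1 := by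
    rw [Complex.norm_real, Real.norm_of_nonneg (by positivity), div_le_one (by positivity)]
    exact hs1
  rw [e2, norm_mul, norm_mul, norm_exp_I_mul_mul, one_mul]
  refine (mul_le_of_le_one_left (norm_nonneg _) hn).trans ?_
  refine norm_integral_le_of_norm_le ?_ (Eventually.of_forall fun η => ?_)
  · refine integrable_gaussian.mul_bdd (c := 2) (Continuous.aestronglyMeasurable (by fun_prop))
      (Eventually.of_forall fun η => ?_)
    rw [Real.norm_of_nonneg (by positivity)]
    exact min_le_left _ _
  · rw [norm_mul, norm_mul, norm_exp_I_mul_mul, one_mul, Complex.norm_real,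
      Real.norm_of_nonneg (Real.exp_pos _).le]
    gcongr
    exact norm_multiplier_sub_le ht _ _

/-! ### Phases and damping near the revival time -/

/-- The frequency `R + n R^{1-θ}`. -/
noncomputable def frequency (θ R : ℝ) (n : ℕ) : ℝ := R + n * R ^ (1 - θ)

/-- The time after which the frequencies near `R` of spacing `R^{1-θ}` are in phase again. -/
noncomputable def revivalTime (a θ R : ℝ) : ℝ := 2 * Real.pi / a * R ^ (θ - a)

/-- A bound for the deviation of the multiplier from a constant phase, for times between one and
two revival times. -/
noncomputable def deviation (a γ θ : ℝ) (n : ℕ) (η R : ℝ) : ℝ :=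
  2 * |revivalTime a θ R * (|η + frequency θ R n| ^ a - R ^ a) - 2 * Real.pi * n| +
    (2 * revivalTime a θ R) ^ γ * |η + frequency θ R n| ^ a

section
variable {a γ θ : ℝ}

theorem add_frequency_eq (n : ℕ) (η : ℝ) {R : ℝ} (hR : 0 < R) :
    η + frequency θ R n = R * (1 + (n * R ^ (-θ) + η * R⁻¹)) := by
  rw [frequency, sub_eq_add_neg, Real.rpow_add hR, Real.rpow_one]
  field_simp
  ring

theorem tendsto_relative_frequency (hθ : 0 < θ) (n : ℕ) (η : ℝ) :
    Tendsto (fun R : ℝ => n * R ^ (-θ) + η * R⁻¹) atTop (𝓝 0) := by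
  have h1 := (tendsto_rpow_neg_atTop hθ).const_mul (n : ℝ)
  have h2 := tendsto_inv_atTop_zero.const_mul η
  simpa using h1.add h2

/-- With `u = nR^{-θ} + ηR^{-1}`, the phase difference is `(2π/a) R^θ ((1+u)^a - 1)`, where `R^θ u =
n + ηR^{θ-1} → n` and `((1+u)^a - 1)/u → a`. -/
theorem tendsto_phase (ha : 0 < a) (hθ : 0 < θ) (hθ1 : θ < 1) (n : ℕ) (η : ℝ) :
    Tendsto (fun R : ℝ => revivalTime a θ R * (|η + frequency θ R n| ^ a - R ^ a))
      atTop (𝓝 (2 * Real.pi * n)) := by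
  set g : ℝ → ℝ := fun u => (1 + u) ^ a with hg
  have hgd : HasDerivAt g a 0 := by
    have := ((hasDerivAt_id (0 : ℝ)).const_add 1).rpow_const (p := a) (Or.inl (by simp))
    simpa using this
  -- `dslope` is the difference quotient extended by the derivative, so `u = 0` needs no separate
  -- case.
  have hs : Tendsto (dslope g 0) (𝓝 0) (𝓝 a) := by
    have := (continuousAt_dslope_same.2 hgd.differentiableAt).tendsto
    rwa [dslope_same, hgd.deriv] at this
  have hu := tendsto_relative_frequency hθ n η
  have h1 : Tendsto (fun R : ℝ => (n : ℝ) + η * R ^ (-(1 - θ))) atTop (𝓝 (n + η * 0)) :=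
    ((tendsto_rpow_neg_atTop (sub_pos.2 hθ1)).const_mul η).const_add _
  have h2 := ((h1.mul (hs.comp hu)).const_mul (2 * Real.pi / a))
  have e : 2 * Real.pi / a * ((n + η * 0) * a) = 2 * Real.pi * n := by
    field_simp
    ring
  rw [e] at h2
  refine h2.congr' ?_
  filter_upwards [eventually_gt_atTop 0, hu.eventually (lt_mem_nhds (show (-1 : ℝ) < 0 by norm_num))]
    with R hR hu1
  rw [add_frequency_eq n η hR]
  set u := n * R ^ (-θ) + η * R⁻¹ with hudef
  have hp : 0 < 1 + u := by linarith
  rw [abs_of_pos (mul_pos hR hp), Real.mul_rpow hR.le hp.le, revivalTime]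
  have hd : u * dslope g 0 u = (1 + u) ^ a - 1 := by
    have := sub_smul_dslope g 0 u
    simpa [hg] using this
  have h3 : (n : ℝ) + η * R ^ (-(1 - θ)) = R ^ θ * u := by
    have e1 : R ^ θ * R ^ (-θ) = 1 := by
      rw [← Real.rpow_add hR, add_neg_cancel, Real.rpow_zero]
    have e2 : R ^ (-(1 - θ)) = R ^ θ * R⁻¹ := by
      rw [← Real.rpow_neg_one, ← Real.rpow_add hR]
      congr 1
      ring
    rw [hudef, e2]
    linear_combination -(n : ℝ) * e1
  have h4 : R ^ (θ - a) * R ^ a = R ^ θ := by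
    rw [← Real.rpow_add hR, sub_add_cancel]
  simp only [Function.comp_apply]
  rw [h3]
  linear_combination (2 * Real.pi / a) * R ^ θ * hd -
    (2 * Real.pi / a) * ((1 + u) ^ a - 1) * h4

/-- The expression is a constant times `R^{-(γ(a-θ)-a)}` times a factor tending to 1. -/
theorem tendsto_damping_exponent (ha : 0 < a) (hθ : 0 < θ) (hγ : a < γ * (a - θ)) (n : ℕ)
    (η : ℝ) :
    Tendsto (fun R : ℝ => (2 * revivalTime a θ R) ^ γ * |η + frequency θ R n| ^ a)
      atTop (𝓝 0) := by
  have hu := tendsto_relative_frequency hθ n η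
  have h1 : Tendsto (fun R : ℝ => |1 + (n * R ^ (-θ) + η * R⁻¹)| ^ a) atTop (𝓝 1) := by
    have := (hu.const_add 1).abs.rpow_const (p := a) (Or.inr ha.le)
    simpa using this
  have h2 : Tendsto (fun R : ℝ => R ^ (-(γ * (a - θ) - a))) atTop (𝓝 0) :=
    tendsto_rpow_neg_atTop (sub_pos.2 hγ)
  have h3 := (h2.mul h1).const_mul ((2 * (2 * Real.pi / a)) ^ γ)
  rw [zero_mul, mul_zero] at h3
  refine h3.congr' ?_
  filter_upwards [eventually_gt_atTop 0] with R hR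
  have hpi := Real.pi_pos
  rw [add_frequency_eq n η hR, abs_mul, abs_of_pos hR, Real.mul_rpow hR.le (abs_nonneg _),
    revivalTime, ← mul_assoc 2,
    Real.mul_rpow (x := 2 * (2 * Real.pi / a)) (by positivity) (by positivity),
    ← Real.rpow_mul hR.le]
  have e : R ^ (-(γ * (a - θ) - a)) = R ^ ((θ - a) * γ) * R ^ a := by
    rw [← Real.rpow_add hR]
    congr 1
    ring
  rw [e]
  ring

theorem tendsto_deviation (ha : 0 < a) (hθ : 0 < θ) (hθ1 : θ < 1) (hγ : a < γ * (a - θ)) (n : ℕ)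
    (η : ℝ) : Tendsto (deviation a γ θ n η) atTop (𝓝 0) := by
  have h1 := ((tendsto_phase ha hθ hθ1 n η).sub_const (2 * Real.pi * n)).abs.const_mul 2
  have h2 := h1.add (tendsto_damping_exponent ha hθ hγ n η)
  simpa [deviation] using! h2

theorem revivalTime_pos (ha : 0 < a) {R : ℝ} (hR : 0 < R) : 0 < revivalTime a θ R := by
  have := Real.pi_pos
  unfold revivalTime
  positivity

theorem deviation_nonneg (ha : 0 < a) (n : ℕ) (η : ℝ) {R : ℝ} (hR : 0 < R) :
    0 ≤ deviation a γ θ n η R := by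
  have := revivalTime_pos (θ := θ) ha hR
  unfold deviation
  positivity

theorem tendsto_integral_deviation (ha : 0 < a) (hθ : 0 < θ) (hθ1 : θ < 1)
    (hγ : a < γ * (a - θ)) (n : ℕ) :
    Tendsto (fun R => ∫ η : ℝ, Real.exp (-η ^ 2 / 2) * min 2 (deviation a γ θ n η R))
      atTop (𝓝 0) := by
  have h0 : ∫ _ : ℝ, (0 : ℝ) = 0 := integral_zero _ _
  rw [← h0]
  refine tendsto_integral_filter_of_dominated_convergence (fun η => Real.exp (-η ^ 2 / 2) * 2)
    ?_ ?_ (integrable_gaussian.mul_const 2) ?_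
  · refine Eventually.of_forall fun R => Continuous.aestronglyMeasurable ?_
    have hr : Continuous fun η : ℝ => |η + frequency θ R n| ^ a :=
      (continuous_id.add continuous_const).abs.rpow_const fun _ => Or.inr ha.le
    unfold deviation
    fun_prop
  · filter_upwards [eventually_gt_atTop 0] with R hR
    refine Eventually.of_forall fun η => ?_
    have := deviation_nonneg (γ := γ) (θ := θ) ha n η hR
    rw [Real.norm_of_nonneg (by positivity)]
    gcongr
    exact min_le_left _ _
  · refine Eventually.of_forall fun η => ?_
    have h1 : Tendsto (fun R => min 2 (deviation a γ θ n η R)) atTop (𝓝 (min 2 0)) :=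
      tendsto_const_nhds.min (tendsto_deviation ha hθ hθ1 hγ n η)
    simpa using h1.const_mul (Real.exp (-η ^ 2 / 2))

theorem tendsto_revivalTime (hθ : θ < a) : Tendsto (revivalTime a θ) atTop (𝓝 0) := by
  have := (tendsto_rpow_neg_atTop (sub_pos.2 hθ)).const_mul (2 * Real.pi / a)
  simpa [revivalTime] using! this

/-- Evolution of a wave packet for times between one and two revival times. -/
theorem norm_landau_wavePacket_frequency_sub_le (ha : 0 < a) (hγ : 0 ≤ γ) {R s : ℝ} (hR : 0 < R)
    (hs : 1 ≤ s) (hs2 : s ≤ 2) (n : ℕ) (x : ℝ) :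
    ‖landau a γ (s * revivalTime a θ R) (wavePacket (frequency θ R n)) x -
      Complex.exp (Complex.I * (frequency θ R n : ℝ) * x) *
      Complex.exp (Complex.I * (s * (revivalTime a θ R * R ^ a + 2 * Real.pi * n) : ℝ)) *
        (Real.exp (-x ^ 2 / 2) : ℂ)‖ ≤
    ∫ η : ℝ, Real.exp (-η ^ 2 / 2) * min 2 (deviation a γ θ n η R) := by
  have hT := revivalTime_pos (θ := θ) ha hR
  refine (norm_landau_wavePacket_sub_le ha (by positivity) _ _ _).trans ?_
  have hr : Continuous fun η : ℝ => |η + frequency θ R n| ^ a :=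
    (continuous_id.add continuous_const).abs.rpow_const fun _ => Or.inr ha.le
  refine integral_mono_of_nonneg (Eventually.of_forall fun η => ?_) ?_
    (Eventually.of_forall fun η => ?_)
  · simp only [Pi.zero_apply]
    positivity
  · refine integrable_gaussian.mul_bdd (c := 2) (Continuous.aestronglyMeasurable ?_)
      (Eventually.of_forall fun η => ?_)
    · unfold deviation
      fun_prop
    · have := deviation_nonneg (γ := γ) (θ := θ) ha n η hR
      rw [Real.norm_of_nonneg (by positivity)]
      exact min_le_left _ _
  · simp only [deviation]
    gcongr
    -- The phase error scales with `s ≤ 2`, which explains both factors 2 in `deviation`.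
    have e : s * revivalTime a θ R * |η + frequency θ R n| ^ a -
        s * (revivalTime a θ R * R ^ a + 2 * Real.pi * n) =
        s * (revivalTime a θ R * (|η + frequency θ R n| ^ a - R ^ a) - 2 * Real.pi * n) := by ring
    rw [e, abs_mul, abs_of_pos (by linarith)]
    gcongr

end

/-! ### Averages of packets: small norm -/

/-- The average of the first `N` wave packets with frequencies in arithmetic progression. -/
noncomputable def packetAverage (θ : ℝ) (N : ℕ) (R : ℝ) : ℝ → ℂ :=
  (N : ℂ)⁻¹ • ∑ n ∈ Finset.range N, wavePacket (frequency θ R n)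

theorem integral_gaussian_mul_norm_sq_sum (N : ℕ) (l : ℕ → ℝ) :
    ∫ x : ℝ, Real.exp (-x ^ 2 / 2) *
      ‖∑ n ∈ Finset.range N, Complex.exp (Complex.I * l n * x)‖ ^ 2 =
    ∑ n ∈ Finset.range N, ∑ m ∈ Finset.range N,
      Real.sqrt (2 * Real.pi) * Real.exp (-(l n - l m) ^ 2 / 2) := by
  rw [← Complex.ofReal_inj, ← integral_complex_ofReal]
  have e : ∀ x : ℝ, ((Real.exp (-x ^ 2 / 2) *
      ‖∑ n ∈ Finset.range N, Complex.exp (Complex.I * l n * x)‖ ^ 2 : ℝ) : ℂ) =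
      ∑ n ∈ Finset.range N, ∑ m ∈ Finset.range N,
        (Real.exp (-x ^ 2 / 2) : ℂ) * Complex.exp (Complex.I * (l n - l m : ℝ) * x) := by
    intro x
    have h : ((‖∑ n ∈ Finset.range N, Complex.exp (Complex.I * l n * x)‖ ^ 2 : ℝ) : ℂ) =
        (∑ n ∈ Finset.range N, Complex.exp (Complex.I * l n * x)) *
        ∑ m ∈ Finset.range N, Complex.exp (-(Complex.I * l m * x)) := by
      rw [Complex.ofReal_pow, ← Complex.mul_conj', map_sum]
      congr 1
      refine Finset.sum_congr rfl fun m _ => ?_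
      rw [← Complex.exp_conj]
      simp
    rw [Complex.ofReal_mul, h, Finset.sum_mul_sum, Finset.mul_sum]
    refine Finset.sum_congr rfl fun n _ => ?_
    rw [Finset.mul_sum]
    refine Finset.sum_congr rfl fun m _ => ?_
    rw [← Complex.exp_add]
    congr 2
    push_cast
    ring
  have i : ∀ s : ℝ, Integrable fun x : ℝ =>
      (Real.exp (-x ^ 2 / 2) : ℂ) * Complex.exp (Complex.I * s * x) := fun s =>
    integrable_wavePacket s
  rw [integral_congr_ae (Eventually.of_forall e), integral_finsetSum _ fun n _ =>
    integrable_finsetSum _ fun m _ => i _, Complex.ofReal_sum]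
  refine Finset.sum_congr rfl fun n _ => ?_
  rw [integral_finsetSum _ fun m _ => i _, Complex.ofReal_sum]
  exact Finset.sum_congr rfl fun m _ => integral_gaussian_mul_exp _

/-- Off-diagonal terms contain `exp(-(n-m)² R^{2(1-θ)}/2)` and vanish in the limit; the diagonal
contributes `N` equal terms. -/
theorem tendsto_integral_gaussian_mul_norm_sq_sum {θ : ℝ} (hθ1 : θ < 1) (N : ℕ) :
    Tendsto (fun R => ∫ x : ℝ, Real.exp (-x ^ 2 / 2) *
      ‖∑ n ∈ Finset.range N, Complex.exp (Complex.I * (frequency θ R n : ℝ) * x)‖ ^ 2)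
      atTop (𝓝 (N * Real.sqrt (2 * Real.pi))) := by
  have e : (N * Real.sqrt (2 * Real.pi) : ℝ) = ∑ n ∈ Finset.range N, ∑ m ∈ Finset.range N,
      if n = m then Real.sqrt (2 * Real.pi) else 0 := by
    have : ∀ n ∈ Finset.range N, (∑ m ∈ Finset.range N,
        if n = m then Real.sqrt (2 * Real.pi) else 0) = Real.sqrt (2 * Real.pi) := by
      intro n hn
      rw [Finset.sum_ite_eq, if_pos hn]
    rw [Finset.sum_congr rfl this]
    simp
  simp only [integral_gaussian_mul_norm_sq_sum]
  rw [e]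
  refine tendsto_finsetSum _ fun n _ => tendsto_finsetSum _ fun m _ => ?_
  by_cases h : n = m
  · simp [h]
  · rw [if_neg h]
    have hc : 0 < ((n : ℝ) - m) ^ 2 / 2 := by
      have : (n : ℝ) - m ≠ 0 := sub_ne_zero.2 (by exact_mod_cast h)
      positivity
    have h1 : Tendsto (fun R : ℝ => ((n : ℝ) - m) ^ 2 / 2 * (R ^ (1 - θ)) ^ 2) atTop atTop :=
      ((tendsto_pow_atTop two_ne_zero).comp
        (tendsto_rpow_atTop (sub_pos.2 hθ1))).const_mul_atTop hc
    have h2 := (Real.tendsto_exp_neg_atTop_nhds_zero.comp h1).const_mul (Real.sqrt (2 * Real.pi))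
    rw [mul_zero] at h2
    refine h2.congr fun R => ?_
    simp only [Function.comp_apply, frequency]
    congr 2
    ring

theorem packetAverage_apply (θ : ℝ) (N : ℕ) (R x : ℝ) :
    packetAverage θ N R x = (Real.exp (-x ^ 2 / 2) : ℂ) * ((N : ℂ)⁻¹ *
      ∑ n ∈ Finset.range N, Complex.exp (Complex.I * (frequency θ R n : ℝ) * x)) := by
  simp only [packetAverage, Pi.smul_apply, Finset.sum_apply, wavePacket, smul_eq_mul,
    ← Finset.mul_sum]
  ring

theorem memLp_packetAverage {p : ℝ≥0∞} (hp : 1 ≤ p) (θ : ℝ) (N : ℕ) (R : ℝ) :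
    MemLp (packetAverage θ N R) p volume :=
  (memLp_finsetSum' _ fun _ _ => memLp_wavePacket hp _).const_smul _

/-- The `L¹` norm of a packet average is controlled by orthogonality. -/
theorem integral_norm_packetAverage_le (θ R : ℝ) {N : ℕ} {ε : ℝ} (hε : 0 < ε) (hN : 1 / ε ^ 2 ≤ N)
    (hI : ∫ x : ℝ, Real.exp (-x ^ 2 / 2) *
      ‖∑ n ∈ Finset.range N, Complex.exp (Complex.I * (frequency θ R n : ℝ) * x)‖ ^ 2 ≤
        2 * (N * Real.sqrt (2 * Real.pi))) :
    ∫ x : ℝ, ‖packetAverage θ N R x‖ ≤ 3 * Real.sqrt (2 * Real.pi) * ε := by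
  have hN0 : (0 : ℝ) < N := lt_of_lt_of_le (by positivity) hN
  set F : ℝ → ℂ := fun x => ∑ n ∈ Finset.range N,
    Complex.exp (Complex.I * (frequency θ R n : ℝ) * x) with hF
  have hFc : Continuous F := by
    rw [hF]
    fun_prop
  have hFb : ∀ x, ‖F x‖ ≤ N := by
    intro x
    refine (norm_sum_le _ _).trans_eq ?_
    simp [norm_exp_I_mul_mul]
  have i2 : Integrable fun x : ℝ => Real.exp (-x ^ 2 / 2) * ‖F x‖ ^ 2 := by
    refine integrable_gaussian.mul_bdd (c := (N : ℝ) ^ 2)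
      (Continuous.aestronglyMeasurable (by fun_prop)) (Eventually.of_forall fun x => ?_)
    rw [Real.norm_of_nonneg (by positivity)]
    gcongr
    exact hFb x
  have hpt : ∀ x, ‖packetAverage θ N R x‖ ≤
      ε * Real.exp (-x ^ 2 / 2) + 1 / (ε * N ^ 2) * (Real.exp (-x ^ 2 / 2) * ‖F x‖ ^ 2) := by
    intro x
    rw [packetAverage_apply, norm_mul, norm_mul, norm_inv, Complex.norm_natCast, Complex.norm_real,
      Real.norm_of_nonneg (Real.exp_pos _).le]
    -- This is `y ≤ ε + y²/ε`, in place of Cauchy–Schwarz; after integration the quadratic term is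
    -- of order `1/(εN) ≤ ε`.
    have h1 : (N : ℝ)⁻¹ * ‖F x‖ ≤ ε + 1 / (ε * N ^ 2) * ‖F x‖ ^ 2 := by
      have h2 : 1 / (ε * N ^ 2) * ‖F x‖ ^ 2 = ((N : ℝ)⁻¹ * ‖F x‖) ^ 2 / ε := by
        field_simp
      rw [h2]
      set y := (N : ℝ)⁻¹ * ‖F x‖ with hy
      rw [← sub_nonneg, show ε + y ^ 2 / ε - y = ((ε - y / 2) ^ 2 + 3 / 4 * y ^ 2) / ε by
        field_simp
        ring]
      positivity
    calc Real.exp (-x ^ 2 / 2) * ((N : ℝ)⁻¹ * ‖F x‖)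
        ≤ Real.exp (-x ^ 2 / 2) * (ε + 1 / (ε * N ^ 2) * ‖F x‖ ^ 2) := by gcongr
      _ = _ := by ring
  calc ∫ x : ℝ, ‖packetAverage θ N R x‖
      ≤ ∫ x : ℝ, (ε * Real.exp (-x ^ 2 / 2) +
          1 / (ε * N ^ 2) * (Real.exp (-x ^ 2 / 2) * ‖F x‖ ^ 2)) :=
        integral_mono (memLp_one_iff_integrable.1 (memLp_packetAverage le_rfl θ N R)).norm
          ((integrable_gaussian.const_mul _).add (i2.const_mul _)) hpt
    _ = ε * Real.sqrt (2 * Real.pi) +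
          1 / (ε * N ^ 2) * ∫ x : ℝ, Real.exp (-x ^ 2 / 2) * ‖F x‖ ^ 2 := by
        rw [integral_add (integrable_gaussian.const_mul _) (i2.const_mul _), integral_const_mul,
          integral_const_mul, integral_gaussian_half]
    _ ≤ ε * Real.sqrt (2 * Real.pi) +
          1 / (ε * N ^ 2) * (2 * (N * Real.sqrt (2 * Real.pi))) := by gcongr
    _ = ε * Real.sqrt (2 * Real.pi) + 2 * Real.sqrt (2 * Real.pi) * (1 / (ε * N)) := by
        field_simp
    _ ≤ ε * Real.sqrt (2 * Real.pi) + 2 * Real.sqrt (2 * Real.pi) * ε := by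
        gcongr
        rw [div_le_iff₀ (by positivity)] at hN ⊢
        linarith
    _ = _ := by ring

theorem norm_packetAverage_le_one (θ : ℝ) (N : ℕ) (R x : ℝ) : ‖packetAverage θ N R x‖ ≤ 1 := by
  rw [packetAverage_apply, norm_mul, norm_mul, norm_inv, Complex.norm_natCast, Complex.norm_real,
    Real.norm_of_nonneg (Real.exp_pos _).le]
  have h1 : ‖∑ n ∈ Finset.range N, Complex.exp (Complex.I * (frequency θ R n : ℝ) * x)‖ ≤ N := by
    refine (norm_sum_le _ _).trans_eq ?_
    simp [norm_exp_I_mul_mul]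
  have h2 : Real.exp (-x ^ 2 / 2) ≤ 1 := by
    rw [Real.exp_le_one_iff]
    nlinarith [sq_nonneg x]
  have h3 : (N : ℝ)⁻¹ * ‖∑ n ∈ Finset.range N,
      Complex.exp (Complex.I * (frequency θ R n : ℝ) * x)‖ ≤ 1 :=
    (mul_le_mul_of_nonneg_left h1 (by positivity)).trans (inv_mul_le_one)
  exact mul_le_one₀ h2 (by positivity) h3

/-- A function bounded by one with small `L¹` norm has small `L^p` norm. -/
theorem eLpNorm_le_of_integral_norm_le {p : ℝ≥0∞} (hp : 1 ≤ p) (hp' : p ≠ ∞) {f : ℝ → ℂ}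
    (hf : Integrable f) (hb : ∀ x, ‖f x‖ ≤ 1) {η : ℝ} (hη : 0 < η)
    (h : ∫ x, ‖f x‖ ≤ η ^ p.toReal) : eLpNorm f p volume ≤ ENNReal.ofReal η := by
  have h0 : 0 < p.toReal := ENNReal.toReal_pos (by positivity) hp'
  have h1 : 1 ≤ p.toReal := by
    simpa using (ENNReal.toReal_le_toReal ENNReal.one_ne_top hp').mpr hp
  rw [eLpNorm_eq_lintegral_rpow_enorm_toReal (by positivity) hp', one_div,
    ENNReal.rpow_inv_le_iff h0, ENNReal.ofReal_rpow_of_pos hη]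
  refine le_trans (lintegral_mono fun x => ?_)
    ((ofReal_integral_norm_eq_lintegral_enorm hf).symm.le.trans (ENNReal.ofReal_le_ofReal h))
  have h' : ‖f x‖ₑ ≤ 1 := by
    rw [← ofReal_norm, ENNReal.ofReal_le_one]
    exact hb x
  simpa using ENNReal.rpow_le_rpow_of_exponent_ge h' h1

/-! ### Refocusing at a given point -/

theorem landau_zero {a γ t : ℝ} (x : ℝ) : landau a γ t 0 x = 0 := by
  have := landau_const_smul (a := a) (γ := γ) (t := t) (p := 1) le_rfl (by norm_num)
    (f := 0) 0 MemLp.zero x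
  simpa using this

theorem landau_sum {p : ℝ≥0∞} (hp : 1 ≤ p) (hp2 : p ≤ 2) {a γ t : ℝ} (ha : 0 < a) (ht : 0 < t)
    (s : Finset ℕ) (f : ℕ → ℝ → ℂ) (hf : ∀ n, MemLp (f n) p volume) (x : ℝ) :
    landau a γ t (∑ n ∈ s, f n) x = ∑ n ∈ s, landau a γ t (f n) x := by
  induction s using Finset.induction_on with
  | empty => simp [landau_zero]
  | insert n s hn ih =>
    rw [Finset.sum_insert hn, Finset.sum_insert hn,
      landau_add hp hp2 ha ht (hf n) (memLp_finsetSum' s fun n _ => hf n), ih]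

/-- At some time between one and two revival times, the packets are in phase at `x`. -/
theorem exists_le_norm_landau_packetAverage {a γ θ : ℝ} (ha : 0 < a) (hγ : 0 ≤ γ) {R : ℝ}
    (hR : 0 < R) {N : ℕ} (hN : 0 < N)
    (hdev : ∀ n ∈ Finset.range N,
      ∫ η : ℝ, Real.exp (-η ^ 2 / 2) * min 2 (deviation a γ θ n η R) ≤ 1 / 4)
    {x : ℝ} (hx : x ∈ Set.Icc (0 : ℝ) 1) :
    ∃ s, 1 ≤ s ∧ s ≤ 2 ∧ 1 / 4 ≤ ‖landau a γ (s * revivalTime a θ R) (packetAverage θ N R) x‖ := by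
  have hpi := Real.pi_pos
  set ω := R ^ (1 - θ) with hω
  set q := ω * x / (2 * Real.pi) with hq
  -- Chosen so that `ωx + 2πs = 2πk` with `s` in `[1,2]`: the `n`-dependent part of the phase is
  -- then `2πnk`.
  set k : ℤ := ⌈1 + q⌉ with hk
  set s : ℝ := k - q with hs
  have hs1 : 1 ≤ s := by
    have := Int.le_ceil (1 + q)
    linarith
  have hs2 : s ≤ 2 := by
    have := Int.ceil_lt_add_one (1 + q)
    linarith
  refine ⟨s, hs1, hs2, ?_⟩
  set T := revivalTime a θ R with hTdef
  have hT : 0 < T := revivalTime_pos ha hR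
  have hN' : (0 : ℝ) < N := by exact_mod_cast hN
  have hNc : (N : ℂ) ≠ 0 := by exact_mod_cast hN.ne'
  set m : ℕ → ℂ := fun n => Complex.exp (Complex.I * (frequency θ R n : ℝ) * x) *
      Complex.exp (Complex.I * (s * (T * R ^ a + 2 * Real.pi * n) : ℝ)) *
        (Real.exp (-x ^ 2 / 2) : ℂ) with hm
  set c : ℂ := Complex.exp (Complex.I * (R * x + s * (T * R ^ a) : ℝ)) *
    (Real.exp (-x ^ 2 / 2) : ℂ) with hc
  have hmc : ∀ n, m n = c := by
    intro n
    have e : Complex.I * (frequency θ R n : ℝ) * x +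
        Complex.I * (s * (T * R ^ a + 2 * Real.pi * n) : ℝ) =
        Complex.I * (R * x + s * (T * R ^ a) : ℝ) +
          ((n * k : ℤ) : ℂ) * (2 * Real.pi * Complex.I) := by
      have hq' : (ω : ℂ) * x = 2 * Real.pi * q := by
        rw [← Complex.ofReal_mul, hq]
        push_cast
        field_simp
      have hs' : (s : ℂ) = k - q := by
        rw [hs]
        push_cast
        ring
      rw [frequency]
      push_cast
      linear_combination Complex.I * n * hq' + Complex.I * 2 * Real.pi * n * hs'
    rw [hm, hc]
    simp only
    rw [← Complex.exp_add, e, Complex.exp_add, Complex.exp_int_mul_two_pi_mul_I, mul_one]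
  have hL : landau a γ (s * T) (packetAverage θ N R) x =
      (N : ℂ)⁻¹ * ∑ n ∈ Finset.range N,
        landau a γ (s * T) (wavePacket (frequency θ R n)) x := by
    -- The operator does not depend on `p`, so linearity may be used in `L¹`.
    have hmem : ∀ n, MemLp (wavePacket (frequency θ R n)) 1 volume := fun n =>
      memLp_wavePacket le_rfl _
    rw [packetAverage, landau_const_smul le_rfl (by norm_num) _ (memLp_finsetSum' _ fun n _ =>
      hmem n), landau_sum le_rfl (by norm_num) ha (by positivity) _ _ hmem]
  have hd : ‖landau a γ (s * T) (packetAverage θ N R) x - c‖ ≤ 1 / 4 := by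
    have e : landau a γ (s * T) (packetAverage θ N R) x - c = (N : ℂ)⁻¹ *
        ∑ n ∈ Finset.range N, (landau a γ (s * T) (wavePacket (frequency θ R n)) x - m n) := by
      rw [hL, Finset.sum_sub_distrib, Finset.sum_congr rfl fun n _ => hmc n, Finset.sum_const,
        Finset.card_range, nsmul_eq_mul, mul_sub, inv_mul_cancel_left₀ hNc]
    rw [e, norm_mul, norm_inv, Complex.norm_natCast, inv_mul_le_iff₀ hN']
    refine (norm_sum_le _ _).trans ((Finset.sum_le_sum fun n hn =>
      (norm_landau_wavePacket_frequency_sub_le ha hγ hR hs1 hs2 n x).trans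
        (hdev n hn)).trans_eq ?_)
    simp
  have hcn : 1 / 2 ≤ ‖c‖ := by
    rw [hc, norm_mul, norm_exp_I_mul, one_mul, Complex.norm_real,
      Real.norm_of_nonneg (Real.exp_pos _).le]
    have := Real.add_one_le_exp (-x ^ 2 / 2)
    nlinarith [hx.1, hx.2]
  have := norm_sub_norm_le c (landau a γ (s * T) (packetAverage θ N R) x)
  rw [norm_sub_rev] at this
  linarith

/-- The order of choice is `θ` from `a` and `γ`, then `N` from the target norm, then `R` large
depending on `N`. -/
theorem hasLargeMaximalFunction {a γ : ℝ} (ha : 0 < a) (hγ : 1 < γ) {p : ℝ≥0∞} (hp : 1 ≤ p)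
    (hp' : p ≠ ∞) : HasLargeMaximalFunction a γ p := by
  intro η hη
  obtain ⟨θ, hθ, hθ'⟩ : ∃ θ, 0 < θ ∧ θ < min 1 (a * (1 - 1 / γ)) := by
    refine exists_between (lt_min one_pos (mul_pos ha (sub_pos.2 ?_)))
    rw [div_lt_one (by linarith)]
    exact hγ
  have hθ1 : θ < 1 := hθ'.trans_le (min_le_left _ _)
  have hθγ : θ < a * (1 - 1 / γ) := hθ'.trans_le (min_le_right _ _)
  have hγ0 : 0 < γ := by linarith
  have hθa : a < γ * (a - θ) := by
    have e : γ * (a * (1 - 1 / γ)) = γ * a - a := by field_simp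
    nlinarith
  have hθa' : θ < a := by
    by_contra hc
    nlinarith
  -- The `L¹` bound `3√(2π) ε` then equals `η^p`, which suffices for functions bounded by 1.
  set ε := η ^ p.toReal / (3 * Real.sqrt (2 * Real.pi)) with hε
  have hε0 : 0 < ε := by positivity
  obtain ⟨N, hN⟩ := exists_nat_ge (1 / ε ^ 2)
  have hN0 : (0 : ℝ) < N := lt_of_lt_of_le (by positivity) hN
  have h1 : ∀ᶠ R in atTop, ∀ n ∈ Finset.range N,
      ∫ η : ℝ, Real.exp (-η ^ 2 / 2) * min 2 (deviation a γ θ n η R) ≤ 1 / 4 := by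
    rw [Filter.eventually_all_finset]
    intro n _
    exact (tendsto_integral_deviation ha hθ hθ1 hθa n).eventually_le_const (by norm_num)
  have h2 := (tendsto_integral_gaussian_mul_norm_sq_sum hθ1 N).eventually_le_const
    (u := 2 * (N * Real.sqrt (2 * Real.pi))) (by
      have : 0 < N * Real.sqrt (2 * Real.pi) := by positivity
      linarith)
  -- Half of `η`, since the times used reach twice the revival time.
  have h3 := (tendsto_revivalTime hθa').eventually_le_const (half_pos hη)
  obtain ⟨R, hR1, hR2, hR3, hR⟩ := (h1.and (h2.and (h3.and (eventually_gt_atTop 0)))).exists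
  have hT := revivalTime_pos (θ := θ) ha hR
  refine ⟨packetAverage θ N R, memLp_packetAverage hp θ N R, ?_, revivalTime a θ R, hT,
    fun x hx => ?_⟩
  · refine eLpNorm_le_of_integral_norm_le hp hp'
      (memLp_one_iff_integrable.1 (memLp_packetAverage le_rfl θ N R))
      (norm_packetAverage_le_one θ N R) hη
      ((integral_norm_packetAverage_le θ R hε0 hN hR2).trans_eq ?_)
    rw [hε]
    field_simp
  · obtain ⟨s, hs1, hs2, hs⟩ := exists_le_norm_landau_packetAverage ha hγ0.le hR
      (by exact_mod_cast hN0) hR1 hx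
    refine ⟨s * revivalTime a θ R, ?_, ?_, hs⟩ <;> nlinarith

end LandauSchrodinger

theorem theorem1p1 (a γ : ℝ) (ha : 0 < a) (hγ : 1 < γ) (p : ℝ≥0∞) (hp : 1 ≤ p) (hp2 : p < 2) :
    ∃ (f₀ : ℝ → ℂ) (E : Set ℝ), MemLp f₀ p volume ∧ MeasurableSet E ∧ 0 < volume E ∧
      ∀ x ∈ E, ¬ Tendsto (fun t : ℝ => LandauSchrodinger.landau a γ t f₀ x) (𝓝[>] 0) (𝓝 (f₀ x)) := by
  have : Fact (1 ≤ p) := ⟨hp⟩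
  obtain ⟨f, hf, h⟩ := LandauSchrodinger.exists_forall_not_tendsto hp2.le ha
    (zero_le_one.trans hγ.le)
    (LandauSchrodinger.hasLargeMaximalFunction ha hγ hp hp2.ne_top)
  -- No complex number is a limit, so the choice of representative of `f` is immaterial.
  exact ⟨f, Set.Icc 0 1, hf, measurableSet_Icc, by simp, fun x hx => h x hx (f x)⟩
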